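/- Let $M$ be a finite metric space. Let $\mathrm{TP}(M)$ be the real vector space of functions $f:M\to\mathbb{R}$ with $\sum_{x\in M} f(x)=0$, with the norm $$\|f\|_{\mathrm{TC}}=\min\Big\{\sum_{i=1}^m a_i\,d(x_i,y_i)\;:\; m\ge 0,\ a_i\ge 0,\ x_i,y_i\in M,\ f=\sum_{i=1}^m a_i(\mathbf 1_{x_i}-\mathbf 1_{y_i})\Big\},$$ and let the transportation cost space $\mathrm{TC}(M)$ be the completion of $\mathrm{TP}(M)$ in this norm. A subspace of a normed space is called $1$-complemented if it is the range of a linear projection of norm at most $1$. Isometric copies of $\ell_1^k$ are understood as linear subspaces that are linearly isometric to $\mathbb{R}^k$ with the norm $\sum_{i=1}^k|a_i|$. A perfect matching of $M$ is a partition of $M$ into pairs $\{u,v\}$ of distinct points, and its weight is the sum of the distances $d(u,v)$ over these pairs. Theorem. Suppose that $M$ has exactly $2n$ elements. (a) $\mathrm{TC}(M)$ contains a $1$-complemented subspace isometric to $\ell_1^n$. More precisely, $M$ has a perfect matching of minimum weight, and for every perfect matching $\{u_1,v_1\},\dots,\{u_n,v_n\}$ of minimum weight the linear span of the functions $\mathbf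 1_{u_i}-\mathbf 1_{v_i}$ $(1\le i\le n)$ is $1$-complemented in $\mathrm{TC}(M)$, and there is a linear isometry of $\ell_1^n$ onto this span that takes the $i$-th unit vector to $(\mathbf 1_{u_i}-\mathbf 1_{v_i})/d(u_i,v_i)$ for each $i$. (b) If moreover $d(x,z)<d(x,y)+d(y,z)$ for all triples of pairwise distinct points $x,y,z\in M$, then $\mathrm{TC}(M)$ contains no subspace isometric to $\ell_1^{n+1}$. -/

import Mathlib

open scoped NNReal

noncomputable section

namespace TransportationCost

/-- The finitely supported real functions on `M` whose values sum to zero. -/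
def zeroSum (M : Type*) : Submodule ℝ (M →₀ ℝ) :=
  LinearMap.ker (Finsupp.linearCombination ℝ (fun _ : M => (1 : ℝ)))

theorem mem_zeroSum {M : Type*} (f : M →₀ ℝ) :
    f ∈ zeroSum M ↔ (f.sum fun _ a => a) = 0 := by
  simp [zeroSum, Finsupp.linearCombination_apply]

/-- The vector space of transportation problems on `M`. -/
def TP (M : Type*) : Type _ := ↥(zeroSum M)

instance (M : Type*) : AddCommGroup (TP M) := inferInstanceAs (AddCommGroup (zeroSum M))

instance (M : Type*) : Module ℝ (TP M) := inferInstanceAs (Module ℝ (zeroSum M))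

/-- A transportation problem, seen as a finitely supported function. -/
def TP.toFinsupp (M : Type*) : TP M →ₗ[ℝ] (M →₀ ℝ) := (zeroSum M).subtype

theorem TP.toFinsupp_injective (M : Type*) : Function.Injective (TP.toFinsupp M) :=
  Subtype.coe_injective

/-- The transportation problem `1_x - 1_y`. -/
def delta {M : Type*} (x y : M) : TP M :=
  ⟨Finsupp.single x 1 - Finsupp.single y 1, by simp [zeroSum]⟩

theorem toFinsupp_delta {M : Type*} (x y : M) :
    TP.toFinsupp M (delta x y) = Finsupp.single x 1 - Finsupp.single y 1 := rfl

theorem delta_swap {M : Type*} (x y : M) : delta y x = -delta x y := by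
  apply TP.toFinsupp_injective
  rw [map_neg, toFinsupp_delta, toFinsupp_delta, neg_sub]

/-- A transportation plan: a finite list of deliveries `(a, x, y)`, each meaning that `a ≥ 0`
units are moved from `x` to `y`. -/
abbrev Plan (M : Type*) : Type _ := List (ℝ≥0 × M × M)

/-- The transportation problem `∑ aᵢ (1_{xᵢ} - 1_{yᵢ})` solved by a plan. -/
def Plan.problem {M : Type*} (p : Plan M) : TP M :=
  (p.map fun t => (t.1 : ℝ) • delta t.2.1 t.2.2).sum

theorem exists_plan {M : Type*} (f : TP M) : ∃ p : Plan M, p.problem = f := by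
  classical
  rcases isEmpty_or_nonempty M with hM | ⟨⟨o⟩⟩
  · refine ⟨[], TP.toFinsupp_injective M ?_⟩
    exact Subsingleton.elim _ _
  · have key : ∀ s : Finset M, ∃ p : Plan M,
        p.problem = ∑ x ∈ s, TP.toFinsupp M f x • delta x o := by
      intro s
      induction s using Finset.induction_on with
      | empty => exact ⟨[], rfl⟩
      | insert a s ha ih =>
        obtain ⟨p, hp⟩ := ih
        rw [Finset.sum_insert ha]
        rcases le_total 0 (TP.toFinsupp M f a) with h | h
        · refine ⟨(Real.toNNReal (TP.toFinsupp M f a), a, o) :: p, ?_⟩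
          rw [← hp]
          simp [Plan.problem, h]
        · refine ⟨(Real.toNNReal (-TP.toFinsupp M f a), o, a) :: p, ?_⟩
          rw [← hp, Plan.problem, List.map_cons, List.sum_cons, delta_swap a o,
            Real.coe_toNNReal _ (neg_nonneg.2 h)]
          simp [Plan.problem]
    obtain ⟨p, hp⟩ := key (TP.toFinsupp M f).support
    refine ⟨p, hp.trans (TP.toFinsupp_injective M ?_)⟩
    rw [map_sum]
    simp only [map_smul, toFinsupp_delta, smul_sub, Finset.sum_sub_distrib]
    have h0 : (∑ x ∈ (TP.toFinsupp M f).support, TP.toFinsupp M f x) = 0 :=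
      (mem_zeroSum _).1 f.2
    rw [← Finset.sum_smul, h0, zero_smul, sub_zero]
    conv_rhs => rw [← Finsupp.sum_single (TP.toFinsupp M f)]
    simp [Finsupp.sum]

/-- The cost `∑ aᵢ d(xᵢ, yᵢ)` of a plan. -/
def Plan.cost {M : Type*} [MetricSpace M] (p : Plan M) : ℝ :=
  (p.map fun t => (t.1 : ℝ) * dist t.2.1 t.2.2).sum

/-- The transportation cost of a problem: the least cost of a plan solving it. -/
instance (M : Type*) [MetricSpace M] : Norm (TP M) where
  norm f := sInf {c : ℝ | ∃ p : Plan M, p.problem = f ∧ p.cost = c}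

section Norm

variable {M : Type*} [MetricSpace M]

theorem norm_def (f : TP M) :
    ‖f‖ = sInf {c : ℝ | ∃ p : Plan M, p.problem = f ∧ p.cost = c} := rfl

theorem Plan.cost_nonneg (p : Plan M) : 0 ≤ p.cost := by
  apply List.sum_nonneg
  intro c hc
  obtain ⟨t, -, rfl⟩ := List.mem_map.1 hc
  positivity

theorem norm_le_cost (p : Plan M) : ‖p.problem‖ ≤ p.cost :=
  csInf_le ⟨0, by rintro c ⟨q, -, rfl⟩; exact q.cost_nonneg⟩ ⟨p, rfl, rfl⟩

theorem le_norm (f : TP M) (b : ℝ) (h : ∀ p : Plan M, p.problem = f → b ≤ p.cost) : b ≤ ‖f‖ := by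
  obtain ⟨p, hp⟩ := exists_plan f
  refine le_csInf ⟨_, p, hp, rfl⟩ ?_
  rintro c ⟨q, hq, rfl⟩
  exact h q hq

theorem exists_plan_lt (f : TP M) {b : ℝ} (h : ‖f‖ < b) :
    ∃ p : Plan M, p.problem = f ∧ p.cost < b := by
  by_contra! hc
  exact absurd (le_norm f b hc) (not_le.2 h)

/-- Scaling a plan by a real number `c`, reversing it if `c` is negative. -/
theorem exists_plan_smul (c : ℝ) (p : Plan M) :
    ∃ q : Plan M, q.problem = c • p.problem ∧ q.cost = |c| * p.cost := by
  induction p with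
  | nil => exact ⟨[], by simp [Plan.problem], by simp [Plan.cost]⟩
  | cons t p ih =>
    obtain ⟨q, hq, hq'⟩ := ih
    have e1 : Plan.problem (t :: p) = (t.1 : ℝ) • delta t.2.1 t.2.2 + Plan.problem p := by
      simp [Plan.problem]
    have e2 : Plan.cost (t :: p) = (t.1 : ℝ) * dist t.2.1 t.2.2 + Plan.cost p := by
      simp [Plan.cost]
    rcases le_total 0 c with h | h
    · refine ⟨(Real.toNNReal c * t.1, t.2.1, t.2.2) :: q, ?_, ?_⟩
      · rw [e1, smul_add, ← hq, smul_smul]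
        simp [Plan.problem, h]
      · rw [e2, mul_add, ← hq', abs_of_nonneg h]
        simp [Plan.cost, mul_assoc, h]
    · refine ⟨(Real.toNNReal (-c) * t.1, t.2.2, t.2.1) :: q, ?_, ?_⟩
      · rw [e1, smul_add, ← hq, smul_smul, Plan.problem, List.map_cons, List.sum_cons,
          delta_swap t.2.1 t.2.2,
          NNReal.coe_mul, Real.coe_toNNReal _ (neg_nonneg.2 h)]
        simp [Plan.problem]
      · rw [e2, mul_add, ← hq', abs_of_nonpos h, dist_comm, Plan.cost, List.map_cons,
          List.sum_cons, NNReal.coe_mul, Real.coe_toNNReal _ (neg_nonneg.2 h)]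
        simp [Plan.cost, mul_assoc]

/-- A `1`-Lipschitz function bounds the transportation cost from below. -/
theorem pairing_le_norm (l : M → ℝ) (hl : ∀ x y, l x - l y ≤ dist x y) (f : TP M) :
    Finsupp.linearCombination ℝ l (TP.toFinsupp M f) ≤ ‖f‖ := by
  refine le_norm _ _ ?_
  rintro p rfl
  induction p with
  | nil => simp [Plan.problem, Plan.cost]
  | cons t p ih =>
    have e1 : Plan.problem (t :: p) = (t.1 : ℝ) • delta t.2.1 t.2.2 + Plan.problem p := by
      simp [Plan.problem]
    have e2 : Plan.cost (t :: p) = (t.1 : ℝ) * dist t.2.1 t.2.2 + Plan.cost p := by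
      simp [Plan.cost]
    have e3 : Finsupp.linearCombination ℝ l (TP.toFinsupp M (delta t.2.1 t.2.2))
        = l t.2.1 - l t.2.2 := by
      simp [toFinsupp_delta]
    rw [e1, e2, map_add, map_smul, map_add, map_smul, e3, smul_eq_mul]
    have := mul_le_mul_of_nonneg_left (hl t.2.1 t.2.2) t.1.2
    simp only [NNReal.val_eq_coe] at this
    linarith

theorem norm_core : NormedSpace.Core ℝ (TP M) where
  norm_nonneg f := le_norm f 0 fun p _ => p.cost_nonneg
  norm_smul c f := by
    have le : ∀ (c : ℝ) (f : TP M), ‖c • f‖ ≤ |c| * ‖f‖ := by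
      intro c f
      rcases eq_or_ne c 0 with rfl | hc
      · have := norm_le_cost (M := M) []
        simpa [Plan.problem, Plan.cost] using this
      · have hc' : 0 < |c| := abs_pos.2 hc
        rw [mul_comm, ← div_le_iff₀ hc']
        refine le_norm _ _ ?_
        rintro p rfl
        obtain ⟨q, hq, hq'⟩ := exists_plan_smul c p
        rw [div_le_iff₀ hc', mul_comm, ← hq', ← hq]
        exact norm_le_cost q
    refine le_antisymm (le c f) ?_
    rcases eq_or_ne c 0 with rfl | hc
    · rw [norm_zero, zero_mul]
      exact le_norm _ 0 fun p _ => p.cost_nonneg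
    · have h := le c⁻¹ (c • f)
      rw [smul_smul, inv_mul_cancel₀ hc, one_smul, abs_inv] at h
      have hc' : 0 < |c| := abs_pos.2 hc
      rw [Real.norm_eq_abs]
      calc |c| * ‖f‖ ≤ |c| * (|c|⁻¹ * ‖c • f‖) := by gcongr
        _ = ‖c • f‖ := by rw [← mul_assoc, mul_inv_cancel₀ hc'.ne', one_mul]
  norm_triangle f g := by
    refine le_of_forall_pos_le_add fun ε hε => ?_
    obtain ⟨p, rfl, hp⟩ := exists_plan_lt f (b := ‖f‖ + ε / 2) (by linarith)
    obtain ⟨q, rfl, hq⟩ := exists_plan_lt g (b := ‖g‖ + ε / 2) (by linarith)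
    have h := norm_le_cost (M := M) (p ++ q)
    have e1 : Plan.problem (p ++ q) = p.problem + q.problem := by simp [Plan.problem]
    have e2 : Plan.cost (p ++ q) = p.cost + q.cost := by simp [Plan.cost]
    rw [e1, e2] at h
    linarith
  norm_eq_zero_iff f := by
    classical
    constructor
    · intro h0
      by_contra hf
      have hf' : TP.toFinsupp M f ≠ 0 := fun h =>
        hf (TP.toFinsupp_injective M (h.trans (map_zero _).symm))
      -- it suffices to separate a point of positive value from the rest of the support
      obtain ⟨v, hv⟩ : ∃ v, 0 < TP.toFinsupp M f v := by
        by_contra! hneg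
        have hs : (∑ x ∈ (TP.toFinsupp M f).support, TP.toFinsupp M f x) = 0 :=
          (mem_zeroSum _).1 f.2
        rw [Finset.sum_eq_zero_iff_of_nonpos fun x _ => hneg x] at hs
        apply hf'
        ext x
        by_cases hx : x ∈ (TP.toFinsupp M f).support
        · exact hs x hx
        · exact Finsupp.notMem_support_iff.1 hx
      obtain ⟨δ, hδ, hδ'⟩ : ∃ δ > 0, ∀ x ∈ (TP.toFinsupp M f).support, x ≠ v → δ ≤ dist x v := by
        have : ∀ s : Finset M, ∃ δ > 0, ∀ x ∈ s, x ≠ v → δ ≤ dist x v := by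
          intro s
          induction s using Finset.induction_on with
          | empty => exact ⟨1, one_pos, by simp⟩
          | insert a s ha ih =>
            obtain ⟨δ, hδ, h⟩ := ih
            by_cases hav : a = v
            · refine ⟨δ, hδ, fun x hx hxv => ?_⟩
              rcases Finset.mem_insert.1 hx with rfl | hx
              · exact absurd hav hxv
              · exact h x hx hxv
            · refine ⟨min δ (dist a v), lt_min hδ (dist_pos.2 hav), fun x hx hxv => ?_⟩
              rcases Finset.mem_insert.1 hx with rfl | hx
              · exact min_le_right _ _
              · exact (min_le_left _ _).trans (h x hx hxv)
        exact this _
      have hle := pairing_le_norm (fun x => max 0 (δ - dist x v)) (fun x y => by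
        have h1 := dist_triangle y x v
        rw [dist_comm y x] at h1
        rcases le_total 0 (δ - dist x v) with h | h
        · have := le_max_right 0 (δ - dist y v)
          rw [max_eq_right h]
          linarith
        · have := le_max_left 0 (δ - dist y v)
          have := dist_nonneg (x := x) (y := y)
          rw [max_eq_left h]
          linarith) f
      have hsum : Finsupp.linearCombination ℝ (fun x => max 0 (δ - dist x v)) (TP.toFinsupp M f)
          = TP.toFinsupp M f v * δ := by
        rw [Finsupp.linearCombination_apply, Finsupp.sum, Finset.sum_eq_single v]
        · simp [hδ.le]
        · intro x hx hxv
          rw [max_eq_left (by linarith [hδ' x hx hxv]), smul_zero]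
        · intro hv'
          rw [Finsupp.notMem_support_iff.1 hv', zero_smul]
      have := mul_pos hv hδ
      linarith
    · rintro rfl
      refine le_antisymm ?_ (le_norm _ 0 fun p _ => p.cost_nonneg)
      have := norm_le_cost (M := M) []
      simpa [Plan.problem, Plan.cost] using this

end Norm

instance (M : Type*) [MetricSpace M] : NormedAddCommGroup (TP M) :=
  NormedAddCommGroup.ofCore (𝕜 := ℝ) norm_core

instance (M : Type*) [MetricSpace M] : NormedSpace ℝ (TP M) :=
  NormedSpace.ofCore norm_core

/-- The transportation cost space: the completion of the space of transportation problems with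
respect to the transportation cost norm. -/
abbrev TC (M : Type*) [MetricSpace M] : Type _ := UniformSpace.Completion (TP M)

/-- `ℓ₁ⁿ`: the space `ℝⁿ` with the norm `∑ |aᵢ|`. -/
abbrev EllOne (n : ℕ) : Type := PiLp 1 (fun _ : Fin n => ℝ)

/-- A subspace is `1`-complemented if it is the range of a linear projection of norm at most `1`
(for a nonzero subspace the norm is then equal to `1`). -/
def IsOneComplemented {E : Type*} [NormedAddCommGroup E] [NormedSpace ℝ E]
    (S : Submodule ℝ E) : Prop :=
  ∃ P : E →L[ℝ] E, LinearMap.IsProj S P ∧ ‖P‖ ≤ 1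

section Matching

variable {M : Type*} [MetricSpace M]

/-- The length of an edge: the distance between its ends. -/
def edgeLength : Sym2 M → ℝ := Sym2.lift ⟨fun x y => dist x y, dist_comm⟩

/-- The weight of a matching: the sum of the lengths of its edges. -/
def weight [Finite M] (W : (⊤ : SimpleGraph M).Subgraph) : ℝ :=
  ∑ e ∈ W.edgeSet.toFinite.toFinset, edgeLength e

/-- A perfect matching in the complete graph on `M` of the least possible weight. -/
def IsMinWeightPerfectMatching [Finite M] (W : (⊤ : SimpleGraph M).Subgraph) : Prop :=
  W.IsPerfectMatching ∧
    ∀ W' : (⊤ : SimpleGraph M).Subgraph, W'.IsPerfectMatching → weight W ≤ weight W'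

/-- `u₁v₁, …, uₙvₙ` is a list without repetition of all the edges of `W`. -/
def EnumeratesEdges {n : ℕ} (W : (⊤ : SimpleGraph M).Subgraph) (u v : Fin n → M) : Prop :=
  Function.Injective (fun i => s(u i, v i)) ∧ Set.range (fun i => s(u i, v i)) = W.edgeSet

end Matching

end TransportationCost

end

/-! (a) A perfect matching of least weight is a join of least weight whose vertices of odd degree
are all the points of `M`: any edge set with all degrees odd contains, by the triangle inequality,
the length of a perfect matching (`exists_matching_le`). Equivalently, reversing the sign of the
lengths on the matching `J` leaves every edge set with all degrees even with nonnegative signed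
weight; for a join `J`, taking the symmetric difference with such a set gives another join.

For such a `J` there is a fractional packing of cuts, each crossed by exactly one edge of `J`, that
uses up the full length of every edge of `J` and at most the length of any other edge
(`exists_cut_packing`). A packing of maximal total weight does this: while some edge of `J` has
positive residual length, contract the edges of residual length zero and take a shortest join for
the signed weight. Near one end `b` of it, `J` has a single edge, and the star of `b` can be
shortened a little without making a closed set negative (`exists_tight_star`, `exists_shortening`).

Assigning each cut to the one matching edge that crosses it, with a sign, gives a map of `M` to
`ℓ₁ⁿ` that is `1`-Lipschitz and preserves the length of each matched pair in its own coordinate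
(`exists_coordinates`). Its linear extension to `TC M` is a contraction and a left inverse of the
map sending the unit vectors to the normalized pairs, which gives both the isometry and the
projection.

(b) If `‖f ± g‖ = ‖f‖ + ‖g‖`, a common norming `1`-Lipschitz function and the strict triangle
inequality force `f` and `g` to have disjoint supports (`disjoint_support`). A nonzero problem has
at least two points in its support, so `ℓ₁ᵏ` needs `2 * k` points. -/

noncomputable section

namespace TransportationCost

set_option linter.unusedSectionVars false

/-! ### Joins modulo two and shortest joins for signed weights -/

section Joins

variable {E V : Type*} [DecidableEq E] [DecidableEq V]

/-- The indicator of a vertex, modulo two. -/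
def pt (v : V) : V → ZMod 2 := Pi.single v 1

/-- The incidence vector, modulo two, of the edge `e` with ends `s e` and `t e`. -/
def inc (s t : E → V) (e : E) : V → ZMod 2 := pt (s e) + pt (t e)

/-- The indicator of the vertices of odd degree in the edge set `C`. -/
def bd (s t : E → V) (C : Finset E) : V → ZMod 2 := ∑ e ∈ C, inc s t e

/-- The weight `d`, with the sign reversed on `J`. -/
def swt (J : Finset E) (d : E → ℝ) (e : E) : ℝ := if e ∈ J then -d e else d e

/-- The indicator of the edges that are not loops and have `b` as an end. -/
def star (s t : E → V) (b : V) (e : E) : ℝ := if inc s t e b ≠ 0 then 1 else 0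

theorem zmod_two_eq_one {x : ZMod 2} (h : x ≠ 0) : x = 1 := by
  revert x; decide

theorem zmod_two_fun_add_self {V : Type*} (X : V → ZMod 2) : X + X = 0 := by
  funext v
  exact CharTwo.add_self_eq_zero (X v)

theorem pt_self (v : V) : pt v v = 1 := by simp [pt]

theorem pt_of_ne {v w : V} (h : w ≠ v) : pt v w = 0 := by simp [pt, h]

/-- Modulo two a loop has incidence vector zero, so being nonzero at `a` already excludes loops. -/
theorem exists_inc_eq {s t : E → V} {e : E} {a : V} (h : inc s t e a ≠ 0) :
    ∃ z, z ≠ a ∧ inc s t e = pt a + pt z := by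
  by_cases h1 : s e = a
  · by_cases h2 : t e = a
    · rw [inc, h1, h2, zmod_two_fun_add_self] at h
      exact absurd rfl h
    · exact ⟨t e, h2, by rw [inc, h1]⟩
  · by_cases h2 : t e = a
    · exact ⟨s e, h1, by rw [inc, h2, add_comm]⟩
    · exact absurd (by simp [inc, pt_of_ne (Ne.symm h1), pt_of_ne (Ne.symm h2)]) h

theorem inc_eq_of_ne {s t : E → V} {e : E} {a y : V} (ha : inc s t e a ≠ 0)
    (hy : inc s t e y ≠ 0) (hay : y ≠ a) : inc s t e = pt a + pt y := by
  obtain ⟨z, hz, h⟩ := exists_inc_eq ha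
  have : y = z := by
    by_contra hyz
    rw [h] at hy
    exact hy (by simp [pt_of_ne hay, pt_of_ne hyz])
  rw [h, this]

theorem bd_empty (s t : E → V) : bd s t ∅ = 0 := rfl

theorem bd_singleton (s t : E → V) (e : E) : bd s t {e} = inc s t e := by simp [bd]

theorem bd_union {s t : E → V} {C D : Finset E} (h : Disjoint C D) :
    bd s t (C ∪ D) = bd s t C + bd s t D := Finset.sum_union h

theorem bd_insert {s t : E → V} {C : Finset E} {e : E} (h : e ∉ C) :
    bd s t (insert e C) = inc s t e + bd s t C := Finset.sum_insert h

theorem bd_sdiff {s t : E → V} {C D : Finset E} (h : D ⊆ C) :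
    bd s t (C \ D) = bd s t C + bd s t D := by
  have h1 : bd s t (C \ D) + bd s t D = bd s t C := Finset.sum_sdiff h
  rw [← h1, add_assoc, zmod_two_fun_add_self, add_zero]

theorem bd_erase {s t : E → V} {C : Finset E} {e : E} (h : e ∈ C) :
    bd s t (C.erase e) = bd s t C + inc s t e := by
  rw [← Finset.sdiff_singleton_eq_erase, bd_sdiff (Finset.singleton_subset_iff.2 h), bd_singleton]

theorem bd_symmDiff (s t : E → V) (C D : Finset E) :
    bd s t (symmDiff C D) = bd s t C + bd s t D := by
  have h1 : bd s t (C \ D) + bd s t (C ∩ D) = bd s t C := by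
    rw [← bd_union (Finset.disjoint_sdiff_inter C D), Finset.sdiff_union_inter]
  have h2 : bd s t (D \ C) + bd s t (C ∩ D) = bd s t D := by
    rw [Finset.inter_comm, ← bd_union (Finset.disjoint_sdiff_inter D C), Finset.sdiff_union_inter]
  have h3 : bd s t (symmDiff C D) = bd s t (C \ D) + bd s t (D \ C) :=
    bd_union (disjoint_sdiff_sdiff)
  rw [h3, ← h1, ← h2, add_add_add_comm, zmod_two_fun_add_self, add_zero]

theorem exists_mem_of_bd_ne_zero {s t : E → V} {C : Finset E} {v : V} (h : bd s t C v ≠ 0) :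
    ∃ e ∈ C, inc s t e v ≠ 0 := by
  rw [bd, Finset.sum_apply] at h
  exact Finset.exists_ne_zero_of_sum_ne_zero h

/-- From a vertex of odd degree some trail leads to another vertex of odd degree. -/
theorem exists_subjoin (s t : E → V) (F : Finset E) : ∀ a, bd s t F a ≠ 0 →
    ∃ G ⊆ F, ∃ y, y ≠ a ∧ bd s t F y ≠ 0 ∧ bd s t G = pt a + pt y := by
  induction F using Finset.strongInduction with
  | H F ih =>
    intro a ha
    obtain ⟨e, he, hea⟩ := exists_mem_of_bd_ne_zero ha
    obtain ⟨z, hza, hez⟩ := exists_inc_eq hea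
    by_cases hz : bd s t F z = 0
    -- Deleting `e` makes `a` even and `z` odd, so the trail continues from `z` and cannot end at
    -- `a`.
    · have hF := bd_erase (s := s) (t := t) he
      obtain ⟨G, hG, y, hyz, hy, hGy⟩ := ih _ (Finset.erase_ssubset he) z (by
        rw [hF, hez]
        simp [hz, pt_self, pt_of_ne hza])
      have hya : y ≠ a := by
        rintro rfl
        apply hy
        rw [hF, hez]
        simp only [Pi.add_apply, pt_self, pt_of_ne hza.symm, zmod_two_eq_one ha, add_zero]
        exact CharTwo.add_self_eq_zero 1
      refine ⟨insert e G, ?_, y, hya, ?_, ?_⟩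
      · exact Finset.insert_subset he (hG.trans (Finset.erase_subset _ _))
      · rw [hF, hez] at hy
        simpa [pt_of_ne hya, pt_of_ne hyz] using hy
      · rw [bd_insert (fun h => Finset.notMem_erase e F (hG h)), hGy, hez, add_assoc,
          ← add_assoc (pt z), zmod_two_fun_add_self, zero_add]
    · exact ⟨{e}, Finset.singleton_subset_iff.2 he, z, hza, hz, by rw [bd_singleton, hez]⟩

/-- A join of two vertices contains a join that has just one edge at its end. -/
theorem exists_subjoin_end (s t : E → V) {F : Finset E} {a b : V} (hab : a ≠ b)
    (hF : bd s t F = pt a + pt b) :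
    ∃ G ⊆ F, bd s t G = pt a + pt b ∧
      ∀ e ∈ G, ∀ e' ∈ G, inc s t e b ≠ 0 → inc s t e' b ≠ 0 → e = e' := by
  have hsub : F.filter (fun e => inc s t e b ≠ 0) ⊆ F := Finset.filter_subset _ _
  set D := F.filter (fun e => inc s t e b ≠ 0) with hD
  have hF' := bd_sdiff (s := s) (t := t) hsub
  have hnot : ∀ e ∈ F \ D, inc s t e b = 0 := by
    intro e he
    rw [hD, Finset.mem_sdiff, Finset.mem_filter] at he
    by_contra h
    exact he.2 ⟨he.1, h⟩
  have hedge : ∀ y, y ≠ b → bd s t D y ≠ 0 → ∃ e ∈ F, inc s t e = pt y + pt b := by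
    intro y hyb hy
    obtain ⟨e, he, hey⟩ := exists_mem_of_bd_ne_zero hy
    rw [hD, Finset.mem_filter] at he
    exact ⟨e, he.1, inc_eq_of_ne hey he.2 hyb.symm⟩
  -- Either `a` is odd in `D`, and then an edge `ab` suffices, or a trail avoiding `b` leads from
  -- `a` to some `y` that is odd in `F \ D` and even in `F`, hence odd in `D` and adjacent to `b`.
  by_cases ha : bd s t (F \ D) a = 0
  · have : bd s t D a ≠ 0 := by
      rw [hF', hF] at ha
      intro h0
      simp [h0, pt_self, pt_of_ne hab] at ha
    obtain ⟨e, he, hinc⟩ := hedge a hab this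
    refine ⟨{e}, Finset.singleton_subset_iff.2 he, by rw [bd_singleton, hinc], ?_⟩
    intro x hx x' hx' _ _
    rw [Finset.mem_singleton.1 hx, Finset.mem_singleton.1 hx']
  · obtain ⟨G, hG, y, hya, hy, hGy⟩ := exists_subjoin s t _ a ha
    have hyb : y ≠ b := by
      rintro rfl
      obtain ⟨e, he, h⟩ := exists_mem_of_bd_ne_zero hy
      exact h (hnot e he)
    have : bd s t D y ≠ 0 := by
      rw [hF', hF] at hy
      intro h0
      simp [h0, pt_of_ne hya, pt_of_ne hyb] at hy
    obtain ⟨e, he, hinc⟩ := hedge y hyb this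
    have heb : inc s t e b ≠ 0 := by
      rw [hinc]
      simp [pt_self, pt_of_ne hyb.symm]
    have heG : e ∉ G := fun h => heb (hnot e (hG h))
    refine ⟨insert e G, Finset.insert_subset he (hG.trans Finset.sdiff_subset), ?_, ?_⟩
    · rw [bd_insert heG, hGy, hinc, add_comm, add_assoc, ← add_assoc (pt y),
        zmod_two_fun_add_self, zero_add]
    · have key : ∀ x ∈ insert e G, inc s t x b ≠ 0 → x = e := by
        intro x hx hxb
        rcases Finset.mem_insert.1 hx with h | h
        · exact h
        · exact absurd (hnot x (hG h)) hxb
      exact fun x hx y hy hxb hyb => (key x hx hxb).trans (key y hy hyb).symm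

/-- In an edge set with all degrees even, the edges that can be reached from `b` form a set with
all degrees even. -/
theorem exists_component (s t : E → V) {C : Finset E} (hC : bd s t C = 0) (b : V) :
    ∃ D ⊆ C, bd s t D = 0 ∧ (∀ e ∈ C, inc s t e b ≠ 0 → e ∈ D) ∧
      ∀ e ∈ D, ∀ c, inc s t e c ≠ 0 → ∃ G ⊆ D, bd s t G = pt b + pt c := by
  classical
  let R : V → Prop := fun v => ∃ G ⊆ C, bd s t G = pt b + pt v
  have hR : ∀ e ∈ C, ∀ v w, inc s t e v ≠ 0 → inc s t e w ≠ 0 → R v → R w := by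
    rintro e he v w hv hw ⟨G, hG, hGv⟩
    by_cases hwv : w = v
    · subst hwv
      exact ⟨G, hG, hGv⟩
    refine ⟨symmDiff G {e}, ?_, ?_⟩
    · intro x hx
      rcases Finset.mem_symmDiff.1 hx with h | h
      · exact hG h.1
      · rw [Finset.mem_singleton.1 h.1]
        exact he
    · rw [bd_symmDiff, bd_singleton, hGv, inc_eq_of_ne hv hw hwv, add_assoc, ← add_assoc (pt v),
        zmod_two_fun_add_self, zero_add]
  have hRb : R b := ⟨∅, Finset.empty_subset _, by rw [bd_empty, zmod_two_fun_add_self]⟩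
  -- No edge of `C` leaves the set `R`, so keeping only the edges that meet `R` restricts the
  -- boundary to `R`.
  have hcut : ∀ G ⊆ C, ∀ v,
      bd s t (G.filter (fun e => ∃ v, inc s t e v ≠ 0 ∧ R v)) v = if R v then bd s t G v else 0 := by
    intro G hG v
    rw [bd, bd, Finset.sum_apply, Finset.sum_apply, Finset.sum_filter]
    split_ifs with hv
    · refine Finset.sum_congr rfl fun e he => ?_
      by_cases h0 : inc s t e v = 0
      · simp [h0]
      · rw [if_pos ⟨v, h0, hv⟩]
    · refine Finset.sum_eq_zero fun e he => ?_
      split_ifs with h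
      · obtain ⟨w, hw, hw'⟩ := h
        by_contra h0
        exact hv (hR e (hG he) w v hw h0 hw')
      · rfl
  refine ⟨C.filter (fun e => ∃ v, inc s t e v ≠ 0 ∧ R v), Finset.filter_subset _ _, ?_, ?_, ?_⟩
  · funext v
    simp [hcut C subset_rfl v, hC]
  · intro e he h
    exact Finset.mem_filter.2 ⟨he, b, h, hRb⟩
  · intro e he c hc
    obtain ⟨heC, v, hv, hv'⟩ := Finset.mem_filter.1 he
    have hRc := hR e heC v c hv hc hv'
    obtain ⟨G, hG, hGc⟩ := hRc
    refine ⟨_, Finset.filter_subset_filter _ hG, ?_⟩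
    funext v
    rw [hcut G hG v, hGc]
    split_ifs with hv
    · rfl
    · have h1 : v ≠ b := by
        rintro rfl
        exact hv hRb
      have h2 : v ≠ c := by
        rintro rfl
        exact hv ⟨G, hG, hGc⟩
      simp [pt_of_ne h1, pt_of_ne h2]

theorem pt_add_cancel {V : Type*} [DecidableEq V] (a b c : V) :
    pt a + pt b + (pt b + pt c) = pt a + pt c := by
  rw [add_assoc, ← add_assoc (pt b), zmod_two_fun_add_self, zero_add]

/-- A shortest join of least weight: the vertices `a`, `b` and the edge set `F` minimize the
weight among all joins of two vertices and then the number of edges. -/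
theorem exists_shortest_join [Finite E] [Finite V] [Nonempty V] (s t : E → V) (w : E → ℝ) :
    ∃ (a b : V) (F : Finset E), bd s t F = pt a + pt b ∧
      ∀ (a' b' : V) (G : Finset E), bd s t G = pt a' + pt b' →
        ∑ e ∈ F, w e ≤ ∑ e ∈ G, w e ∧
        (∑ e ∈ G, w e = ∑ e ∈ F, w e → F.card ≤ G.card) := by
  have := Fintype.ofFinite E
  let T := {p : V × V × Finset E // bd s t p.2.2 = pt p.1 + pt p.2.1}
  have : Nonempty T := by
    obtain ⟨v⟩ := ‹Nonempty V›
    exact ⟨⟨(v, v, ∅), by rw [bd_empty, zmod_two_fun_add_self]⟩⟩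
  obtain ⟨⟨⟨a, b, F⟩, hF⟩, hmin⟩ :=
    Finite.exists_min fun p : T => toLex (∑ e ∈ p.1.2.2, w e, p.1.2.2.card)
  refine ⟨a, b, F, hF, fun a' b' G hG => ?_⟩
  have h := hmin ⟨(a', b', G), hG⟩
  rw [Prod.Lex.toLex_le_toLex] at h
  rcases h with h | ⟨h, hcard⟩
  · exact ⟨h.le, fun heq => absurd heq h.ne'⟩
  · exact ⟨h.le, fun _ => hcard⟩

/-- If `J` is a join of least weight, then some vertex meets `J` in a single edge and its
star can be shortened without creating shorter joins, up to the first order. -/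
theorem exists_tight_star [Finite E] [Finite V] (s t : E → V) (d : E → ℝ) (hd : ∀ e, 0 ≤ d e)
    (hloop : ∀ e, d e = 0 → s e = t e) (J : Finset E)
    (hcons : ∀ C, bd s t C = 0 → 0 ≤ ∑ e ∈ C, swt J d e) (hJ : ∃ e ∈ J, d e ≠ 0) :
    ∃ b e₀, (∀ e, (e ∈ J ∧ inc s t e b ≠ 0) ↔ e = e₀) ∧
      ∀ C, bd s t C = 0 → ∑ e ∈ C, swt J d e = 0 → ∑ e ∈ C, swt J (star s t b) e ≤ 0 := by
  obtain ⟨e₁, he₁, he₁d⟩ := hJ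
  have : Nonempty V := ⟨s e₁⟩
  obtain ⟨a, b, F, hF, hmin⟩ := exists_shortest_join s t (swt J d)
  have hdpos : ∀ e v, inc s t e v ≠ 0 → 0 < d e := by
    intro e v h
    refine lt_of_le_of_ne (hd e) fun h0 => h ?_
    rw [inc, hloop e h0.symm, zmod_two_fun_add_self]
    rfl
  have hneg : ∑ e ∈ F, swt J d e < 0 := by
    have h := (hmin (s e₁) (t e₁) {e₁} (bd_singleton _ _ _)).1
    rw [Finset.sum_singleton, swt, if_pos he₁] at h
    have := lt_of_le_of_ne (hd e₁) (Ne.symm he₁d)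
    linarith
  have hab : a ≠ b := by
    rintro rfl
    rw [zmod_two_fun_add_self] at hF
    exact absurd (hcons F hF) (not_le.2 hneg)
  -- The rest `F \ G` joins `a` and `c`, so it is no lighter than `F` and, at equal weight, has no
  -- fewer edges.
  have hirr : ∀ G ⊆ F, ∀ c, bd s t G = pt b + pt c → ∑ e ∈ G, swt J d e ≤ 0 ∧
      (∑ e ∈ G, swt J d e = 0 → G = ∅) := by
    intro G hG c hc
    have h := hmin a c (F \ G) (by rw [bd_sdiff hG, hF, hc, pt_add_cancel])
    have h1 := Finset.sum_sdiff (f := swt J d) hG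
    refine ⟨by linarith [h.1], fun h0 => ?_⟩
    have h2 := h.2 (by linarith)
    have h3 := Finset.card_sdiff_add_card_eq_card hG
    exact Finset.card_eq_zero.1 (by omega)
  have hirr₀ : ∀ G ⊆ F, bd s t G = 0 → G = ∅ := by
    intro G hG h0
    have h := hirr G hG b (by rw [h0, zmod_two_fun_add_self])
    exact h.2 (le_antisymm h.1 (hcons G h0))
  -- A single edge of `F` at `b` is such a `G`, and only edges of `J` have negative weight.
  have hFJ : ∀ e ∈ F, inc s t e b ≠ 0 → e ∈ J := by
    intro e he heb
    obtain ⟨y, -, hy⟩ := exists_inc_eq heb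
    have h := (hirr {e} (Finset.singleton_subset_iff.2 he) y (by rw [bd_singleton, hy])).1
    by_contra heJ
    rw [Finset.sum_singleton, swt, if_neg heJ] at h
    exact absurd (hdpos e b heb) (not_lt.2 h)
  -- Otherwise adding `e` to `F` would give a lighter join.
  have hJF : ∀ e ∈ J, inc s t e b ≠ 0 → e ∈ F := by
    intro e he heb
    by_contra heF
    obtain ⟨y, -, hy⟩ := exists_inc_eq heb
    have h := (hmin a y (insert e F) (by
      rw [bd_insert heF, hF, hy, add_comm, pt_add_cancel])).1
    rw [Finset.sum_insert heF, swt, if_pos he] at h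
    linarith [hdpos e b heb]
  obtain ⟨F', hF'F, hF', huniq⟩ := exists_subjoin_end s t hab hF
  have hFF' : F \ F' = ∅ :=
    hirr₀ _ Finset.sdiff_subset (by rw [bd_sdiff hF'F, hF, hF', zmod_two_fun_add_self])
  have hFb : bd s t F b ≠ 0 := by
    rw [hF]
    simp [pt_self, pt_of_ne hab.symm]
  obtain ⟨e₀, he₀, he₀b⟩ := exists_mem_of_bd_ne_zero hFb
  have hFuniq : ∀ e ∈ F, inc s t e b ≠ 0 → e = e₀ := fun e he heb =>
    huniq e (Finset.sdiff_eq_empty_iff_subset.1 hFF' he) e₀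
      (Finset.sdiff_eq_empty_iff_subset.1 hFF' he₀) heb he₀b
  have he₀J := hFJ e₀ he₀ he₀b
  -- a closed set of weight zero that avoids `e₀` avoids the star of `b`
  have havoid : ∀ C, bd s t C = 0 → ∑ e ∈ C, swt J d e = 0 → e₀ ∉ C →
      ∀ f ∈ C, inc s t f b = 0 := by
    intro C hC hCw he₀C f hfC
    by_contra hfb
    obtain ⟨D, hDC, hD, hDb, hDG⟩ := exists_component s t hC b
    have hfD := hDb f hfC hfb
    -- `D` and `C \ D` are both closed, so their weights are nonnegative with sum zero.
    have hDw : ∑ e ∈ D, swt J d e = 0 := by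
      have h1 := hcons D hD
      have h2 := hcons (C \ D) (by rw [bd_sdiff hDC, hC, hD, add_zero])
      have h3 := Finset.sum_sdiff (f := swt J d) hDC
      linarith
    have he₀D : e₀ ∉ D := fun h => he₀C (hDC h)
    have hFD : bd s t (F \ D) b ≠ 0 := by
      rw [bd, Finset.sum_apply, Finset.sum_eq_single_of_mem e₀ (Finset.mem_sdiff.2 ⟨he₀, he₀D⟩)]
      · exact he₀b
      · intro e he hne
        by_contra h
        exact hne (hFuniq e (Finset.mem_sdiff.1 he).1 h)
    obtain ⟨G, hG, c, hcb, hc, hGc⟩ := exists_subjoin s t _ b hFD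
    have hGF : G ⊆ F := hG.trans Finset.sdiff_subset
    have hGD : Disjoint G D := Finset.disjoint_of_subset_left hG Finset.sdiff_disjoint
    by_cases hcD : bd s t (F ∩ D) c = 0
    · -- `G` joins `a` and `b`, hence is all of `F`, and `F ∪ D` without `f` is too light
      have hca : c = a := by
        by_contra hca
        rw [← Finset.sdiff_inter_self_left, bd_sdiff Finset.inter_subset_left, hF] at hc
        exact hc (by simp [hcD, pt_of_ne hca, pt_of_ne hcb])
      have hFG := hirr₀ (F \ G) Finset.sdiff_subset (by
        rw [bd_sdiff hGF, hF, hGc, hca, add_comm (pt b), zmod_two_fun_add_self])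
      have hFG' : G = F := hGF.antisymm (Finset.sdiff_eq_empty_iff_subset.1 hFG)
      rw [hFG'] at hGD
      obtain ⟨z, -, hz⟩ := exists_inc_eq hfb
      have h := (hmin a z ((F ∪ D).erase f) (by
        rw [bd_erase (Finset.mem_union_right _ hfD), bd_union hGD, hF, hD, hz, add_zero,
          pt_add_cancel])).1
      have h1 := Finset.sum_erase_add (F ∪ D) (swt J d) (Finset.mem_union_right _ hfD)
      rw [Finset.sum_union hGD, hDw] at h1
      have hfJ : f ∉ J := fun hf => he₀D (hFuniq f (hJF f hf hfb) hfb ▸ hfD)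
      have h2 : swt J d f = d f := if_neg hfJ
      linarith [hdpos f b hfb]
    · -- `G` is too light to close either of the two joins into which `c` divides `D`
      obtain ⟨e, he, hec⟩ := exists_mem_of_bd_ne_zero hcD
      obtain ⟨H, hHD, hH⟩ := hDG e (Finset.mem_inter.1 he).2 c hec
      have hG0 := hirr G hGF c hGc
      have hdis : Disjoint G H := Finset.disjoint_of_subset_right hHD hGD
      have hdis' : Disjoint G (D \ H) := Finset.disjoint_of_subset_right Finset.sdiff_subset hGD
      have h1 := hcons (G ∪ H) (by rw [bd_union hdis, hGc, hH, zmod_two_fun_add_self])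
      have h2 := hcons (G ∪ D \ H) (by
        rw [bd_union hdis', bd_sdiff hHD, hGc, hD, hH, zero_add, zmod_two_fun_add_self])
      have h3 := Finset.sum_sdiff (f := swt J d) hHD
      rw [Finset.sum_union hdis] at h1
      rw [Finset.sum_union hdis'] at h2
      have hGe := hG0.2 (by linarith)
      rw [hGe, bd_empty] at hGc
      have := congrFun hGc b
      simp [pt_self, pt_of_ne hcb.symm] at this
  refine ⟨b, e₀, fun e => ⟨fun h => hFuniq e (hJF e h.1 h.2) h.2, ?_⟩, ?_⟩
  · rintro rfl
    exact ⟨he₀J, he₀b⟩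
  intro C hC hCw
  have hzero : ∀ e, inc s t e b = 0 → swt J (star s t b) e = 0 := by
    intro e h
    simp [swt, star, h]
  by_cases he₀C : e₀ ∈ C
  · -- split off a closed set that meets the star of `b` in `e₀` and one other edge
    obtain ⟨y, hyb, hy⟩ := exists_inc_eq he₀b
    obtain ⟨D, hDC, hD, hDuniq⟩ := exists_subjoin_end s t (F := C.erase e₀) hyb (by
      rw [bd_erase he₀C, hC, hy, zero_add, add_comm])
    have he₀D : e₀ ∉ D := fun h => Finset.notMem_erase _ _ (hDC h)
    have hD' : bd s t (insert e₀ D) = 0 := by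
      rw [bd_insert he₀D, hD, hy, add_comm (pt y), zmod_two_fun_add_self]
    have hDC' : insert e₀ D ⊆ C :=
      Finset.insert_subset he₀C (hDC.trans (Finset.erase_subset _ _))
    have hrest : bd s t (C \ insert e₀ D) = 0 := by rw [bd_sdiff hDC', hC, hD', add_zero]
    have h1 := hcons _ hD'
    have h2 := hcons _ hrest
    have h3 := Finset.sum_sdiff (f := swt J d) hDC'
    have h4 := havoid _ hrest (by linarith) (fun h =>
      (Finset.mem_sdiff.1 h).2 (Finset.mem_insert_self _ _))
    rw [← Finset.sum_sdiff hDC', Finset.sum_eq_zero fun e he => hzero e (h4 e he), zero_add,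
      Finset.sum_insert he₀D]
    have h5 : swt J (star s t b) e₀ = -1 := by simp [swt, star, he₀J, he₀b]
    have hDb : bd s t D b ≠ 0 := by
      rw [hD]
      simp [pt_self, pt_of_ne hyb.symm]
    obtain ⟨g, hg, hgb⟩ := exists_mem_of_bd_ne_zero hDb
    have h6 : ∑ e ∈ D, swt J (star s t b) e = swt J (star s t b) g := by
      refine Finset.sum_eq_single_of_mem g hg fun e he hne => hzero e ?_
      by_contra h
      exact hne (hDuniq e he g hg h hgb)
    have h7 : swt J (star s t b) g ≤ 1 := by
      rw [swt, star, if_pos hgb]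
      split_ifs <;> norm_num
    linarith
  · exact (Finset.sum_eq_zero fun e he => hzero e (havoid C hC hCw he₀C e he)).le

end Joins

/-- Finitely many affine inequalities that hold to first order at `0` hold at some `ε > 0`. -/
theorem exists_pos_forall_mul_le {ι : Type*} [Finite ι] (α β : ι → ℝ) (hα : ∀ i, 0 ≤ α i)
    (hβ : ∀ i, α i = 0 → β i ≤ 0) : ∃ ε > 0, ∀ i, ε * β i ≤ α i := by
  have h : ∀ i, ∀ᶠ ε in nhdsWithin (0 : ℝ) (Set.Ioi 0), ε * β i ≤ α i := by
    intro i
    rcases (hα i).eq_or_lt with h0 | h0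
    · filter_upwards [self_mem_nhdsWithin] with ε hε
      rw [← h0]
      exact mul_nonpos_of_nonneg_of_nonpos (le_of_lt hε) (hβ i h0.symm)
    · have hc : Filter.Tendsto (fun ε : ℝ => ε * β i) (nhdsWithin 0 (Set.Ioi 0)) (nhds (0 * β i)) :=
        ((continuous_id.mul continuous_const).tendsto 0).mono_left nhdsWithin_le_nhds
      rw [zero_mul] at hc
      exact (hc.eventually (gt_mem_nhds h0)).mono fun ε hε => le_of_lt hε
  obtain ⟨ε, h1, h2⟩ := ((Filter.eventually_all.2 h).and self_mem_nhdsWithin).exists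
  exact ⟨ε, h2, h1⟩

/-! ### Fractional packings of cuts -/

section Packing

variable {E V : Type*} [DecidableEq E] [DecidableEq V]

/-- The real indicator of a finite set. -/
def ind (B : Finset V) (x : V) : ℝ := if x ∈ B then 1 else 0

/-- The indicator of the edges with just one end in `B`. -/
def cut (s t : E → V) (B : Finset V) (e : E) : ℝ := |ind B (s e) - ind B (t e)|

theorem cut_nonneg (s t : E → V) (B : Finset V) (e : E) : 0 ≤ cut s t B e := abs_nonneg _

/-- The boundaries of sets of edges of length zero. -/
def zeroBoundaries (s t : E → V) (d : E → ℝ) : AddSubgroup (V → ZMod 2) where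
  carrier := {X | ∃ Z : Finset E, (∀ e ∈ Z, d e = 0) ∧ bd s t Z = X}
  zero_mem' := ⟨∅, by simp, bd_empty s t⟩
  add_mem' := by
    rintro X Y ⟨Z, hZ, rfl⟩ ⟨Z', hZ', rfl⟩
    refine ⟨symmDiff Z Z', fun e he => ?_, bd_symmDiff s t Z Z'⟩
    rcases Finset.mem_symmDiff.1 he with h | h
    · exact hZ e h.1
    · exact hZ' e h.1
  neg_mem' := by
    rintro X ⟨Z, hZ, rfl⟩
    refine ⟨Z, hZ, ?_⟩
    rw [← add_eq_zero_iff_eq_neg, zmod_two_fun_add_self]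

/-- Two vertices are equivalent if they are joined by edges of length zero. -/
def zeroSetoid (s t : E → V) (d : E → ℝ) : Setoid V where
  r x y := pt x + pt y ∈ zeroBoundaries s t d
  iseqv :=
    { refl := fun x => by
        rw [zmod_two_fun_add_self]
        exact zero_mem _
      symm := fun {x y} h => by
        rw [add_comm]
        exact h
      trans := fun {x y z} h h' => by
        rw [← pt_add_cancel x y z]
        exact add_mem h h' }

/-- Move every point of `X` to the representative of its class along edges of length zero; an even
number of points arrives at each representative, so they cancel. -/
theorem mem_zeroBoundaries_of_sum_eq_zero [Fintype V] (s t : E → V) (d : E → ℝ)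
    [DecidableEq (Quotient (zeroSetoid s t d))] (X : V → ZMod 2)
    (hX : ∀ q : Quotient (zeroSetoid s t d), ∑ x with Quotient.mk _ x = q, X x = 0) :
    X ∈ zeroBoundaries s t d := by
  let rep : V → V := fun x => (Quotient.mk (zeroSetoid s t d) x).out
  have hsum : X = ∑ x, X x • (pt x + pt (rep x)) := by
    funext v
    rw [Finset.sum_apply]
    have h1 : ∑ x, X x * pt x v = X v := by
      rw [Finset.sum_eq_single_of_mem v (Finset.mem_univ _)]
      · rw [pt_self, mul_one]
      · intro x _ hx
        rw [pt_of_ne hx.symm, mul_zero]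
    have h2 : ∑ x, X x * pt (rep x) v = 0 := by
      by_cases hv : rep v = v
      · rw [← hX (Quotient.mk _ v), Finset.sum_filter]
        refine Finset.sum_congr rfl fun x _ => ?_
        split_ifs with h
        · have : rep x = v := by rw [← hv]; exact congrArg Quotient.out h
          rw [this, pt_self, mul_one]
        · have : v ≠ rep x := by
            intro h'
            apply h
            rw [h']
            exact (Quotient.out_eq _).symm
          rw [pt_of_ne this, mul_zero]
      · refine Finset.sum_eq_zero fun x _ => ?_
        have : v ≠ rep x := by
          intro h'
          apply hv
          rw [h']
          exact congrArg Quotient.out (Quotient.out_eq _)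
        rw [pt_of_ne this, mul_zero]
    simp only [Pi.smul_apply, Pi.add_apply, smul_eq_mul, mul_add, Finset.sum_add_distrib, h1, h2,
      add_zero]
  rw [hsum]
  refine sum_mem fun x _ => ?_
  by_cases h : X x = 0
  · rw [h, zero_smul]
    exact zero_mem _
  · rw [zmod_two_eq_one h, one_smul]
    exact (zeroSetoid s t d).symm (Quotient.mk_out x)

theorem bd_comp [Fintype V] {Q : Type*} [DecidableEq Q] (s t : E → V) (π : V → Q) (C : Finset E)
    (q : Q) : bd (π ∘ s) (π ∘ t) C q = ∑ x with π x = q, bd s t C x := by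
  have h : ∀ v, pt (π v) q = ∑ x with π x = q, pt v x := by
    intro v
    by_cases hv : π v = q
    · rw [Finset.sum_eq_single_of_mem v (by simp [hv])]
      · rw [hv, pt_self, pt_self]
      · intro x _ hx
        exact pt_of_ne hx
    · rw [pt_of_ne (Ne.symm hv)]
      refine (Finset.sum_eq_zero fun x hx => pt_of_ne ?_).symm
      rintro rfl
      exact hv (Finset.mem_filter.1 hx).2
  simp only [bd, Finset.sum_apply]
  rw [Finset.sum_comm]
  refine Finset.sum_congr rfl fun e _ => ?_
  simp only [inc, Pi.add_apply, Finset.sum_add_distrib, Function.comp_apply, h]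

/-- This turns the star found after contraction into a cut of the original graph. -/
theorem star_comp [Fintype V] {Q : Type*} [DecidableEq Q] (s t : E → V) (π : V → Q) (b : Q)
    (e : E) : star (π ∘ s) (π ∘ t) b e = cut s t (Finset.univ.filter fun x => π x = b) e := by
  have h : ∀ q : Q, pt q b = if q = b then 1 else 0 := by
    intro q
    split_ifs with h
    · rw [h, pt_self]
    · exact pt_of_ne (Ne.symm h)
  have h2 : (1 : ZMod 2) + 1 = 0 := CharTwo.add_self_eq_zero 1
  simp only [star, cut, inc, ind, Pi.add_apply, h, Function.comp_apply, Finset.mem_filter,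
    Finset.mem_univ, true_and]
  split_ifs <;> simp_all

theorem swt_sub_mul (J : Finset E) (d g : E → ℝ) (ε : ℝ) (C : Finset E) :
    ∑ e ∈ C, swt J (fun e => d e - ε * g e) e
      = ∑ e ∈ C, swt J d e - ε * ∑ e ∈ C, swt J g e := by
  rw [Finset.mul_sum, ← Finset.sum_sub_distrib]
  refine Finset.sum_congr rfl fun e _ => ?_
  simp only [swt]
  split_ifs <;> ring

/-- As long as the join `J` of least weight has positive weight, the edges across some set that
`J` crosses once can be shortened so that `J` keeps the least weight. -/
theorem exists_shortening [Fintype E] [Fintype V] (s t : E → V) (d : E → ℝ) (hd : ∀ e, 0 ≤ d e)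
    (J : Finset E) (hcons : ∀ C, bd s t C = 0 → 0 ≤ ∑ e ∈ C, swt J d e)
    (hJ : ∃ e ∈ J, d e ≠ 0) :
    ∃ B : Finset V, ∑ e ∈ J, cut s t B e = 1 ∧ ∃ ε > 0, (∀ e, ε * cut s t B e ≤ d e) ∧
      ∀ C, bd s t C = 0 → 0 ≤ ∑ e ∈ C, swt J (fun e => d e - ε * cut s t B e) e := by
  classical
  let π : V → Quotient (zeroSetoid s t d) := Quotient.mk _
  have hloop : ∀ e, d e = 0 → (π ∘ s) e = (π ∘ t) e := by
    intro e he
    refine Quotient.sound (s := zeroSetoid s t d) ⟨{e}, ?_, bd_singleton s t e⟩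
    intro x hx
    rw [Finset.mem_singleton.1 hx, he]
  -- A set closed after contraction becomes closed in `V` by a symmetric difference with edges of
  -- length zero, which do not affect the signed weight.
  have hcons' : ∀ C, bd (π ∘ s) (π ∘ t) C = 0 → 0 ≤ ∑ e ∈ C, swt J d e := by
    intro C hC
    obtain ⟨Z, hZ, hZC⟩ := mem_zeroBoundaries_of_sum_eq_zero s t d (bd s t C) fun q => by
      rw [← bd_comp s t π C q, hC]
      rfl
    have h := hcons (symmDiff C Z) (by rw [bd_symmDiff, hZC, zmod_two_fun_add_self])
    have hw : ∀ e ∈ Z, swt J d e = 0 := by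
      intro e he
      simp [swt, hZ e he]
    have h1 : ∑ e ∈ symmDiff C Z, swt J d e = ∑ e ∈ C \ Z, swt J d e := by
      refine (Finset.sum_subset (fun e he => Finset.mem_symmDiff.2 (Or.inl ?_)) ?_).symm
      · exact Finset.mem_sdiff.1 he
      · intro e he he'
        rcases Finset.mem_symmDiff.1 he with h | h
        · exact absurd (Finset.mem_sdiff.2 h) he'
        · exact hw e h.1
    have h2 : ∑ e ∈ C, swt J d e = ∑ e ∈ C \ Z, swt J d e := by
      refine (Finset.sum_subset Finset.sdiff_subset fun e he he' => hw e ?_).symm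
      by_contra hne
      exact he' (Finset.mem_sdiff.2 ⟨he, hne⟩)
    rw [h2, ← h1]
    exact h
  obtain ⟨b, e₀, he₀, hb⟩ := exists_tight_star (π ∘ s) (π ∘ t) d hd hloop J hcons' hJ
  set B : Finset V := Finset.univ.filter fun x => π x = b with hB
  have hstar : ∀ e, star (π ∘ s) (π ∘ t) b e = cut s t B e := star_comp s t π b
  have hstar' : star (π ∘ s) (π ∘ t) b = cut s t B := funext hstar
  rw [hstar'] at hb
  refine ⟨B, ?_, ?_⟩
  · rw [Finset.sum_eq_single_of_mem e₀ ((he₀ e₀).2 rfl).1]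
    · rw [← hstar, star, if_pos ((he₀ e₀).2 rfl).2]
    · intro e he hne
      rw [← hstar, star, if_neg]
      exact fun h => hne ((he₀ e).1 ⟨he, h⟩)
  -- One constraint for each edge and each closed set. An edge of length zero is a loop of the
  -- quotient and lies in no star; for a closed set of weight zero, `hb` gives the right sign.
  · obtain ⟨ε, hε, h⟩ := exists_pos_forall_mul_le
      (ι := E ⊕ {C : Finset E // bd s t C = 0})
      (Sum.elim d fun C => ∑ e ∈ C.1, swt J d e)
      (Sum.elim (cut s t B) fun C => ∑ e ∈ C.1, swt J (cut s t B) e)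
      (by
        rintro (e | C)
        · exact hd e
        · exact hcons C.1 C.2)
      (by
        rintro (e | C) h0
        · have h1 := hloop e h0
          rw [Sum.elim_inl, ← hstar, star, if_neg]
          rw [inc, h1, zmod_two_fun_add_self]
          simp
        · refine hb C.1 ?_ h0
          funext q
          rw [bd_comp, C.2]
          simp)
    refine ⟨ε, hε, fun e => h (Sum.inl e), fun C hC => ?_⟩
    rw [swt_sub_mul, sub_nonneg]
    exact h (Sum.inr ⟨C, hC⟩)

/-- A join of least weight is matched by a fractional packing of cuts each of which it crosses
once. -/
theorem exists_cut_packing [Fintype E] [Fintype V] (s t : E → V) (d : E → ℝ) (hd : ∀ e, 0 ≤ d e)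
    (J : Finset E) (hcons : ∀ C, bd s t C = 0 → 0 ≤ ∑ e ∈ C, swt J d e) :
    ∃ Y : Finset V → ℝ, (∀ B, 0 ≤ Y B) ∧ (∀ B, Y B ≠ 0 → ∑ e ∈ J, cut s t B e = 1) ∧
      (∀ e, ∑ B, Y B * cut s t B e ≤ d e) ∧ ∀ e ∈ J, ∑ B, Y B * cut s t B e = d e := by
  -- The last condition says that `J` keeps the least weight for the residual lengths, so that
  -- `exists_shortening` can be applied again at a maximum.
  let K : Set (Finset V → ℝ) :=
    {Y | (∀ B, 0 ≤ Y B) ∧ (∀ B, ∑ e ∈ J, cut s t B e ≠ 1 → Y B = 0) ∧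
      (∀ e, ∑ B, Y B * cut s t B e ≤ d e) ∧
      ∀ C, bd s t C = 0 → 0 ≤ ∑ e ∈ C, swt J (fun e => d e - ∑ B, Y B * cut s t B e) e}
  have hclosed : IsClosed K := by
    simp only [K, Set.ofPred_and, Set.ofPred_forall]
    refine IsClosed.inter ?_ (IsClosed.inter ?_ (IsClosed.inter ?_ ?_))
    · exact isClosed_iInter fun B => isClosed_le continuous_const (by fun_prop)
    · exact isClosed_iInter fun B => isClosed_iInter fun _ =>
        isClosed_eq (by fun_prop) continuous_const
    · exact isClosed_iInter fun e => isClosed_le (by fun_prop) continuous_const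
    · refine isClosed_iInter fun C => isClosed_iInter fun _ => isClosed_le continuous_const ?_
      refine continuous_finsetSum _ fun e _ => ?_
      simp only [swt]
      split_ifs <;> fun_prop
  -- A cut that `J` crosses once has its whole coefficient charged to edges of `J`, hence to their
  -- lengths.
  have hsub : K ⊆ Set.Icc 0 (fun _ => ∑ e, d e) := by
    rintro Y ⟨h1, h2, h3, -⟩
    refine ⟨h1, fun B => ?_⟩
    have hD : 0 ≤ ∑ e, d e := Finset.sum_nonneg fun e _ => hd e
    by_cases hB : ∑ e ∈ J, cut s t B e = 1
    · calc Y B = ∑ e ∈ J, Y B * cut s t B e := by rw [← Finset.mul_sum, hB, mul_one]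
        _ ≤ ∑ e ∈ J, d e := Finset.sum_le_sum fun e _ =>
            (Finset.single_le_sum (f := fun B => Y B * cut s t B e)
              (fun B _ => mul_nonneg (h1 B) (cut_nonneg s t B e)) (Finset.mem_univ B)).trans (h3 e)
        _ ≤ ∑ e, d e := Finset.sum_le_univ_sum_of_nonneg hd
    · rw [h2 B hB]
      exact hD
  have hcompact : IsCompact K := isCompact_Icc.of_isClosed_subset hclosed hsub
  have hne : K.Nonempty := ⟨0, by simp, by simp, by simpa using hd, by simpa using hcons⟩
  obtain ⟨Y, ⟨h1, h2, h3, h4⟩, hmax⟩ := hcompact.exists_isMaxOn hne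
    (f := fun Y => ∑ B, Y B) (by fun_prop)
  refine ⟨Y, h1, fun B hB => ?_, h3, fun e he => ?_⟩
  · by_contra h
    exact hB (h2 B h)
  by_contra hne
  -- Residual length left on `J` allows `Y B` to grow by `ε`, against maximality.
  obtain ⟨B, hB, ε, hε, h5, h6⟩ := exists_shortening s t
    (fun e => d e - ∑ B, Y B * cut s t B e) (fun e => sub_nonneg.2 (h3 e)) J h4
    ⟨e, he, fun h => hne (by linarith)⟩
  have hadd : ∀ e, ∑ B', (Y + (Pi.single B ε : Finset V → ℝ)) B' * cut s t B' e
      = ∑ B', Y B' * cut s t B' e + ε * cut s t B e := by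
    intro e
    simp only [Pi.add_apply, add_mul, Finset.sum_add_distrib]
    congr 1
    rw [Finset.sum_eq_single_of_mem B (Finset.mem_univ _)]
    · rw [Pi.single_eq_same]
    · intro B' _ hB'
      rw [Pi.single_eq_of_ne hB', zero_mul]
  have hmem : Y + (Pi.single B ε : Finset V → ℝ) ∈ K := by
    refine ⟨fun B' => ?_, fun B' hB' => ?_, fun e => ?_, fun C hC => ?_⟩
    · have : 0 ≤ (Pi.single B ε : Finset V → ℝ) B' := by
        rw [Pi.single_apply]
        split_ifs <;> linarith
      exact add_nonneg (h1 B') this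
    · have : B' ≠ B := by
        rintro rfl
        exact hB' hB
      simp [h2 B' hB', this]
    · rw [hadd]
      linarith [h5 e]
    · have := h6 C hC
      simpa only [hadd, ← sub_sub] using this
  have h := hmax hmem
  simp only [Set.mem_ofPred_eq, Pi.add_apply, Finset.sum_add_distrib] at h
  rw [Finset.sum_pi_single', if_pos (Finset.mem_univ _)] at h
  linarith

end Packing

/-! ### Norming Lipschitz functions and the upper bound on the dimension of `ℓ₁` subspaces -/

section Functional

variable {M : Type*} [MetricSpace M]

/-- The value at a problem of the functional with values `l` at the points. -/
def pairing (l : M → ℝ) : TP M →ₗ[ℝ] ℝ := Finsupp.linearCombination ℝ l ∘ₗ TP.toFinsupp M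

theorem pairing_delta (l : M → ℝ) (x y : M) : pairing l (delta x y) = l x - l y := by
  simp [pairing, toFinsupp_delta]

theorem pairing_apply [Fintype M] (l : M → ℝ) (f : TP M) :
    pairing l f = ∑ x, TP.toFinsupp M f x * l x := by
  rw [pairing, LinearMap.comp_apply, Finsupp.linearCombination_apply, Finsupp.sum_fintype]
  · rfl
  · simp

theorem pairing_le (l : M → ℝ) (hl : ∀ x y, l x - l y ≤ dist x y) (f : TP M) :
    pairing l f ≤ ‖f‖ := pairing_le_norm l hl f

theorem norm_delta_le (x y : M) : ‖delta x y‖ ≤ dist x y := by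
  have h := norm_le_cost (M := M) [(1, x, y)]
  simpa [Plan.problem, Plan.cost] using h

theorem sum_toFinsupp_eq_zero [Fintype M] (f : TP M) : ∑ x, TP.toFinsupp M f x = 0 := by
  have h : (TP.toFinsupp M f).sum (fun _ a => a) = 0 := (mem_zeroSum _).1 f.2
  rwa [Finsupp.sum_fintype _ _ (fun _ => rfl)] at h

theorem eq_sum_delta [Fintype M] (f : TP M) (o : M) :
    f = ∑ x, TP.toFinsupp M f x • delta x o := by
  apply TP.toFinsupp_injective
  rw [map_sum]
  simp only [map_smul, toFinsupp_delta, smul_sub, Finset.sum_sub_distrib]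
  rw [← Finset.sum_smul, sum_toFinsupp_eq_zero, zero_smul, sub_zero]
  simp

instance [Finite M] : FiniteDimensional ℝ (TP M) :=
  FiniteDimensional.of_injective (TP.toFinsupp M) (TP.toFinsupp_injective M)

/-- Over a finite space the completion adds nothing. -/
def equivTC (M : Type*) [MetricSpace M] [Finite M] : TP M ≃ₗᵢ[ℝ] TC M :=
  LinearIsometryEquiv.ofSurjective UniformSpace.Completion.toComplₗᵢ (by
    have : CompleteSpace (TP M) := FiniteDimensional.complete ℝ (TP M)
    intro x
    have h := (UniformSpace.Completion.isUniformEmbedding_coe (TP M)).isClosedEmbedding.isClosed_range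
    have h2 := UniformSpace.Completion.denseRange_coe (α := TP M)
    have := h.closure_eq ▸ h2 x
    exact this)

theorem equivTC_apply [Finite M] (f : TP M) : equivTC M f = (f : TC M) := rfl

/-- A norming functional, given by a `1`-Lipschitz function. -/
theorem exists_norming [Fintype M] (f : TP M) :
    ∃ l : M → ℝ, (∀ x y, l x - l y ≤ dist x y) ∧ pairing l f = ‖f‖ := by
  obtain ⟨φ, hφ, hφf⟩ := exists_dual_vector'' ℝ f
  rcases isEmpty_or_nonempty M with hM | ⟨⟨o⟩⟩
  · have : f = 0 := TP.toFinsupp_injective M (Subsingleton.elim _ _)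
    exact ⟨0, by simp, by rw [this, map_zero, norm_zero]⟩
  -- The base point `o` is arbitrary: the values of a problem sum to zero, so constants do not
  -- matter.
  refine ⟨fun x => φ (delta x o), fun x y => ?_, ?_⟩
  · have : delta x o - delta y o = delta x y := by
      apply TP.toFinsupp_injective
      rw [map_sub, toFinsupp_delta, toFinsupp_delta, toFinsupp_delta, sub_sub_sub_cancel_right]
    calc φ (delta x o) - φ (delta y o) = φ (delta x y) := by rw [← map_sub, this]
      _ ≤ ‖φ (delta x y)‖ := le_abs_self _
      _ ≤ ‖φ‖ * ‖delta x y‖ := φ.le_opNorm _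
      _ ≤ 1 * ‖delta x y‖ := by gcongr
      _ ≤ dist x y := by rw [one_mul]; exact norm_delta_le x y
  · have h : φ f = ‖f‖ := by simpa using hφf
    rw [← h, pairing_apply]
    conv_rhs => rw [eq_sum_delta f o]
    simp

/-- A norming function cannot be raised at a point of positive value. -/
theorem exists_tight_of_pos [Fintype M] {l : M → ℝ} (hl : ∀ x y, l x - l y ≤ dist x y) {f : TP M}
    (hf : pairing l f = ‖f‖) {x : M} (hx : 0 < TP.toFinsupp M f x) :
    ∃ y, y ≠ x ∧ l x - l y = dist x y := by
  classical
  by_contra! h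
  obtain ⟨ε, hε, hε'⟩ := exists_pos_forall_mul_le (ι := {y : M // y ≠ x})
    (fun y => dist x y - (l x - l y)) (fun _ => 1) (fun y => sub_nonneg.2 (hl x y))
    (fun y hy => absurd (by linarith) (h y.1 y.2))
  -- Were all inequalities at `x` strict, raising `l` at `x` by `ε` would keep it `1`-Lipschitz and
  -- push the pairing beyond the norm.
  have h1 := pairing_le (fun y => l y + if y = x then ε else 0) (fun y z => by
    have := hl y z
    by_cases hy : y = x
    · by_cases hz : z = x
      · simp [hy, hz]
      · have := hε' ⟨z, hz⟩
        simp only [hy, hz, if_true, if_false]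
        linarith
    · simp only [hy, if_false]
      split_ifs <;> linarith) f
  have h2 : pairing (fun y => l y + if y = x then ε else 0) f
      = pairing l f + TP.toFinsupp M f x * ε := by
    simp [pairing_apply, mul_add, Finset.sum_add_distrib]
  have := mul_pos hx hε
  linarith

/-- If the norm is additive on `f` and `g` and the triangle inequality is strict, no point has a
positive value in `f` and a negative value in `g`. -/
theorem not_pos_neg [Fintype M]
    (hstrict : ∀ x y z : M, x ≠ y → y ≠ z → x ≠ z → dist x z < dist x y + dist y z) {f g : TP M}
    (hfg : ‖f + g‖ = ‖f‖ + ‖g‖) {x : M} (hf : 0 < TP.toFinsupp M f x)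
    (hg : TP.toFinsupp M g x < 0) : False := by
  obtain ⟨l, hl, hlfg⟩ := exists_norming (f + g)
  rw [map_add, hfg] at hlfg
  have hlf := pairing_le l hl f
  have hlg := pairing_le l hl g
  obtain ⟨y, hyx, hy⟩ := exists_tight_of_pos hl (le_antisymm hlf (by linarith)) hf
  -- A function norming `f + g` norms both summands. The tight pairs at `x` then add up to `l z - l
  -- y = dist z x + dist x y`, too much for a `1`-Lipschitz function.
  obtain ⟨z, hzx, hz⟩ := exists_tight_of_pos (l := fun x => -l x) (f := -g) (x := x)
    (fun x y => by rw [dist_comm]; linarith [hl y x]) (by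
      rw [norm_neg, map_neg, pairing_apply]
      simp only [mul_neg, Finset.sum_neg_distrib, neg_neg, ← pairing_apply]
      linarith) (by simpa using hg)
  have h1 := hl z y
  rw [dist_comm] at hz
  by_cases hzy : z = y
  · subst hzy
    have := dist_pos.2 hzx
    rw [dist_comm] at hy
    linarith
  · have := hstrict z x y hzx hyx.symm hzy
    linarith

/-- Opposite signs at a common point are excluded by the sum, equal signs by the difference. -/
theorem disjoint_support [Fintype M]
    (hstrict : ∀ x y z : M, x ≠ y → y ≠ z → x ≠ z → dist x z < dist x y + dist y z) {f g : TP M}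
    (h : ‖f + g‖ = ‖f‖ + ‖g‖) (h' : ‖f - g‖ = ‖f‖ + ‖g‖) :
    Disjoint (TP.toFinsupp M f).support (TP.toFinsupp M g).support := by
  rw [Finset.disjoint_left]
  intro x hf hg
  rw [Finsupp.mem_support_iff] at hf hg
  rw [sub_eq_add_neg, ← norm_neg g] at h'
  rcases hf.lt_or_gt with hf | hf <;> rcases hg.lt_or_gt with hg | hg
  · rw [add_comm, add_comm ‖f‖] at h'
    exact not_pos_neg hstrict h' (by simpa using hg) hf
  · rw [add_comm, add_comm ‖f‖] at h
    exact not_pos_neg hstrict h hg hf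
  · exact not_pos_neg hstrict h hf hg
  · exact not_pos_neg hstrict h' hf (by simpa using hg)

theorem two_le_card_support [Fintype M] {f : TP M} (hf : f ≠ 0) :
    2 ≤ (TP.toFinsupp M f).support.card := by
  by_contra! h
  apply hf
  apply TP.toFinsupp_injective
  rw [map_zero]
  ext x
  by_contra hx
  have h1 := sum_toFinsupp_eq_zero f
  rw [Finset.sum_eq_single_of_mem x (Finset.mem_univ _)] at h1
  · exact hx h1
  · intro y _ hyx
    by_contra hy
    exact hyx (Finset.card_le_one.1 (Nat.le_of_lt_succ h) y (Finsupp.mem_support_iff.2 hy) x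
      (Finsupp.mem_support_iff.2 hx))

theorem norm_single_add_single {k : ℕ} (i j : Fin k) :
    ‖(PiLp.single 1 i (1 : ℝ) + PiLp.single 1 j (1 : ℝ) : EllOne k)‖ = 2 := by
  have h : ∀ m : Fin k, |(if m = i then (1 : ℝ) else 0) + (if m = j then (1 : ℝ) else 0)|
      = (if m = i then (1 : ℝ) else 0) + (if m = j then (1 : ℝ) else 0) := fun m =>
    abs_of_nonneg (by split_ifs <;> norm_num)
  rw [PiLp.norm_eq_of_L1]
  simp only [PiLp.add_apply, PiLp.single_apply, Real.norm_eq_abs, h, Finset.sum_add_distrib]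
  norm_num

theorem norm_single_sub_single {k : ℕ} {i j : Fin k} (hij : i ≠ j) :
    ‖(PiLp.single 1 i (1 : ℝ) - PiLp.single 1 j (1 : ℝ) : EllOne k)‖ = 2 := by
  have h : ∀ m : Fin k, |(if m = i then (1 : ℝ) else 0) - (if m = j then (1 : ℝ) else 0)|
      = (if m = i then (1 : ℝ) else 0) + (if m = j then (1 : ℝ) else 0) := by
    intro m
    by_cases hm : m = i
    · simp [hm, hij]
    · split_ifs <;> norm_num
  rw [PiLp.norm_eq_of_L1]
  simp only [PiLp.sub_apply, PiLp.single_apply, Real.norm_eq_abs, h, Finset.sum_add_distrib]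
  norm_num

/-- If the triangle inequality is strict, then `ℓ₁ᵏ` needs at least `2 * k` points. -/
theorem two_mul_le_card [Fintype M]
    (hstrict : ∀ x y z : M, x ≠ y → y ≠ z → x ≠ z → dist x z < dist x y + dist y z) {k : ℕ}
    (J : EllOne k →ₗᵢ[ℝ] TC M) : 2 * k ≤ Fintype.card M := by
  classical
  let f : Fin k → TP M := fun i => (equivTC M).symm (J (PiLp.single 1 i (1 : ℝ)))
  have hf : ∀ i, ‖f i‖ = 1 := by
    intro i
    simp [f]
  have hdis : ∀ i j, i ≠ j →
      Disjoint (TP.toFinsupp M (f i)).support (TP.toFinsupp M (f j)).support := by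
    intro i j hij
    refine disjoint_support hstrict ?_ ?_
    · rw [hf, hf, ← map_add, ← map_add, LinearIsometryEquiv.norm_map, LinearIsometry.norm_map,
        norm_single_add_single]
      norm_num
    · rw [hf, hf, ← map_sub, ← map_sub, LinearIsometryEquiv.norm_map, LinearIsometry.norm_map,
        norm_single_sub_single hij]
      norm_num
  calc 2 * k = ∑ i : Fin k, 2 := by simp [mul_comm]
    _ ≤ ∑ i, (TP.toFinsupp M (f i)).support.card := Finset.sum_le_sum fun i _ =>
        two_le_card_support fun h0 => by
          have := hf i
          rw [h0, norm_zero] at this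
          norm_num at this
    _ = (Finset.univ.biUnion fun i => (TP.toFinsupp M (f i)).support).card :=
        (Finset.card_biUnion fun i _ j _ hij => hdis i j hij).symm
    _ ≤ Fintype.card M := Finset.card_le_univ _

end Functional

/-! ### From minimum perfect matchings to Lipschitz coordinates -/

section PerfectMatching

variable {M : Type*} [MetricSpace M] [DecidableEq M]

/-- The length of an ordered pair of points. -/
def pairDist (e : M × M) : ℝ := dist e.1 e.2

theorem pairDist_nonneg (e : M × M) : 0 ≤ pairDist e := dist_nonneg

theorem pairDist_eq_of_inc {e : M × M} {a z : M} (h : inc Prod.fst Prod.snd e = pt a + pt z)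
    (hza : z ≠ a) : pairDist e = dist a z := by
  have key : ∀ w, w = a ∨ w = z → w = e.1 ∨ w = e.2 := by
    intro w hw
    by_contra! hne
    have h0 := congrFun h w
    rw [inc, Pi.add_apply, Pi.add_apply, pt_of_ne hne.1, pt_of_ne hne.2] at h0
    rcases hw with rfl | rfl
    · simp [pt_self, pt_of_ne hza.symm] at h0
    · simp [pt_self, pt_of_ne hza] at h0
  rcases key a (Or.inl rfl) with h1 | h1 <;> rcases key z (Or.inr rfl) with h2 | h2
  · exact absurd (h2.trans h1.symm) hza
  · rw [h1, h2, pairDist]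
  · rw [h1, h2, pairDist, dist_comm]
  · exact absurd (h2.trans h1.symm) hza

/-- The polygonal inequality, for joins of two points. -/
theorem dist_le_of_join (G : Finset (M × M)) : ∀ a y : M,
    bd Prod.fst Prod.snd G = pt a + pt y → dist a y ≤ ∑ e ∈ G, pairDist e := by
  induction G using Finset.strongInduction with
  | H G ih =>
    intro a y hG
    by_cases hay : y = a
    · rw [hay, dist_self]
      exact Finset.sum_nonneg fun e _ => pairDist_nonneg e
    · obtain ⟨e, he, hea⟩ := exists_mem_of_bd_ne_zero (s := Prod.fst) (t := Prod.snd) (C := G)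
        (v := a) (by
          rw [hG]
          simp [pt_self, pt_of_ne (Ne.symm hay)])
      obtain ⟨z, hza, hz⟩ := exists_inc_eq hea
      have h1 := ih _ (Finset.erase_ssubset he) z y (by
        rw [bd_erase he, hG, hz, add_comm (pt a) (pt y), pt_add_cancel, add_comm])
      have h2 := Finset.sum_erase_add G pairDist he
      rw [pairDist_eq_of_inc hz hza] at h2
      linarith [dist_triangle a z y]

theorem weight_sup_subgraphOfAdj_le [Finite M] (W : (⊤ : SimpleGraph M).Subgraph) {a y : M}
    (h : (⊤ : SimpleGraph M).Adj a y) :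
    weight (W ⊔ (⊤ : SimpleGraph M).subgraphOfAdj h) ≤ weight W + dist a y := by
  classical
  have h1 : (W ⊔ (⊤ : SimpleGraph M).subgraphOfAdj h).edgeSet.toFinite.toFinset
      = insert s(a, y) W.edgeSet.toFinite.toFinset := by
    ext e
    simp
  rw [weight, h1, weight]
  by_cases he : s(a, y) ∈ W.edgeSet.toFinite.toFinset
  · rw [Finset.insert_eq_of_mem he]
    linarith [dist_nonneg (x := a) (y := y)]
  · rw [Finset.sum_insert he, add_comm]
    rfl

/-- A set of edges contains, by the triangle inequality, the length of a matching of the vertices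
of odd degree. -/
theorem exists_matching_le [Finite M] (X : Finset M) : ∀ F : Finset (M × M),
    (∀ x, bd Prod.fst Prod.snd F x ≠ 0 ↔ x ∈ X) →
    ∃ W : (⊤ : SimpleGraph M).Subgraph, W.IsMatching ∧ W.verts = X ∧
      weight W ≤ ∑ e ∈ F, pairDist e := by
  induction X using Finset.strongInduction with
  | H X ih =>
    intro F hF
    rcases X.eq_empty_or_nonempty with rfl | ⟨a, ha⟩
    · refine ⟨⊥, fun v hv => absurd hv (by simp), by simp, ?_⟩
      have : weight (⊥ : (⊤ : SimpleGraph M).Subgraph) = 0 := by simp [weight]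
      rw [this]
      exact Finset.sum_nonneg fun e _ => pairDist_nonneg e
    -- The pair `a, y` costs at most the length of `G`, and `F \ G` is odd exactly at the remaining
    -- points.
    · obtain ⟨G, hGF, y, hya, hy, hG⟩ := exists_subjoin _ _ F a ((hF a).2 ha)
      have hyX := (hF y).1 hy
      obtain ⟨W, hW, hWX, hWF⟩ := ih ((X.erase a).erase y)
        ((Finset.erase_subset _ _).trans_ssubset (Finset.erase_ssubset ha)) (F \ G) (by
          intro x
          rw [bd_sdiff hGF, hG, Finset.mem_erase, Finset.mem_erase, ← hF]
          by_cases hxa : x = a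
          · subst hxa
            have := zmod_two_eq_one ((hF x).2 ha)
            simp [this, pt_self, pt_of_ne hya.symm, CharTwo.add_self_eq_zero]
          · by_cases hxy : x = y
            · subst hxy
              simp [zmod_two_eq_one hy, pt_self, pt_of_ne hya, CharTwo.add_self_eq_zero]
            · simp [pt_of_ne hxa, pt_of_ne hxy, hxa, hxy])
      have hadj : (⊤ : SimpleGraph M).Adj a y := hya.symm
      refine ⟨W ⊔ (⊤ : SimpleGraph M).subgraphOfAdj hadj, ?_, ?_, ?_⟩
      · refine hW.sup (SimpleGraph.Subgraph.IsMatching.subgraphOfAdj hadj) ?_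
        rw [hW.support_eq_verts,
          (SimpleGraph.Subgraph.IsMatching.subgraphOfAdj hadj).support_eq_verts, hWX]
        rw [Set.disjoint_right]
        intro x hx
        rcases hx with rfl | rfl <;> simp
      · rw [SimpleGraph.Subgraph.verts_sup, hWX]
        ext x
        simp only [Finset.coe_erase, SimpleGraph.subgraphOfAdj_verts, Set.mem_union, Set.mem_sdiff,
          Set.mem_singleton_iff, Set.mem_insert_iff, Finset.mem_coe]
        by_cases hxa : x = a
        · simp [hxa, ha]
        · by_cases hxy : x = y
          · simp [hxy, hyX]
          · simp [hxa, hxy]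
      · have h1 := Finset.sum_sdiff (f := pairDist) hGF
        linarith [weight_sup_subgraphOfAdj_le W hadj, dist_le_of_join G a y hG]

variable {n : ℕ} {W : (⊤ : SimpleGraph M).Subgraph} {u v : Fin n → M}

theorem EnumeratesEdges.adj (h : EnumeratesEdges W u v) (i : Fin n) : W.Adj (u i) (v i) := by
  rw [← SimpleGraph.Subgraph.mem_edgeSet, ← h.2]
  exact ⟨i, rfl⟩

theorem EnumeratesEdges.ne (h : EnumeratesEdges W u v) (i : Fin n) : u i ≠ v i := (h.adj i).ne

theorem EnumeratesEdges.injective_pair (h : EnumeratesEdges W u v) :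
    Function.Injective fun i => (u i, v i) := by
  intro i j hij
  apply h.1
  simp only [Prod.mk.injEq] at hij
  simp only [hij.1, hij.2]

theorem EnumeratesEdges.weight_eq [Finite M] (h : EnumeratesEdges W u v) :
    weight W = ∑ i, dist (u i) (v i) := by
  classical
  have h1 : W.edgeSet.toFinite.toFinset = Finset.univ.image fun i => s(u i, v i) := by
    ext e
    simp [← h.2]
  rw [weight, h1, Finset.sum_image fun i _ j _ hij => h.1 hij]
  rfl

theorem EnumeratesEdges.sum_inc (h : EnumeratesEdges W u v) (hW : W.IsPerfectMatching) (x : M) :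
    ∑ i, inc Prod.fst Prod.snd (u i, v i) x = 1 := by
  obtain ⟨w, hw, hw'⟩ := SimpleGraph.Subgraph.isPerfectMatching_iff.1 hW x
  have hmem : s(x, w) ∈ Set.range fun i => s(u i, v i) := by
    rw [h.2]
    exact hw
  obtain ⟨i, hi⟩ := hmem
  have hone : ∀ j, x = u j ∨ x = v j → inc Prod.fst Prod.snd (u j, v j) x = 1 := by
    rintro j (hj | hj)
    · simp [inc, hj, pt_self, pt_of_ne (h.ne j)]
    · simp [inc, hj, pt_self, pt_of_ne (h.ne j).symm]
  rw [Finset.sum_eq_single_of_mem i (Finset.mem_univ _)]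
  · apply hone
    have : x ∈ s(u i, v i) := by
      rw [show s(u i, v i) = s(x, w) from hi]
      exact Sym2.mem_mk_left x w
    exact Sym2.mem_iff.1 this
  · intro j _ hji
    by_contra h0
    apply hji
    apply h.1
    simp only [hi]
    have hadj := h.adj j
    by_cases hu : x = u j
    · rw [← hu] at hadj ⊢
      rw [hw' _ hadj]
    · by_cases hv : x = v j
      · rw [← hv] at hadj ⊢
        rw [hw' _ hadj.symm, Sym2.eq_swap]
      · exact absurd (by simp [inc, pt_of_ne hu, pt_of_ne hv]) h0

/-- All degrees are one, so the handshake formula counts `n` edges. -/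
theorem exists_enumeratesEdges [Fintype M] (hM : Fintype.card M = 2 * n)
    (hW : W.IsPerfectMatching) : ∃ u v : Fin n → M, EnumeratesEdges W u v := by
  classical
  have h1 := W.spanningCoe.sum_degrees_eq_twice_card_edges
  have h2 : ∀ x, W.spanningCoe.degree x = 1 := by
    intro x
    rw [SimpleGraph.Subgraph.degree_spanningCoe]
    exact SimpleGraph.Subgraph.isPerfectMatching_iff_forall_degree.1 hW x
  simp only [h2, Finset.sum_const, Finset.card_univ, smul_eq_mul, mul_one] at h1
  have h3 : W.spanningCoe.edgeFinset.card = n := by omega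
  let e := W.spanningCoe.edgeFinset.equivFinOfCardEq h3
  refine ⟨fun i => (Quot.out (e.symm i).1).1, fun i => (Quot.out (e.symm i).1).2, ?_⟩
  have h4 : (fun i => s((Quot.out (e.symm i).1).1, (Quot.out (e.symm i).1).2))
      = fun i => (e.symm i).1 := by
    funext i
    exact Quot.out_eq _
  rw [EnumeratesEdges, h4]
  refine ⟨Subtype.val_injective.comp e.symm.injective, ?_⟩
  ext x
  constructor
  · rintro ⟨i, rfl⟩
    exact SimpleGraph.mem_edgeFinset.1 (e.symm i).2
  · intro hx
    exact ⟨e ⟨x, by simpa using hx⟩, by simp⟩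

theorem exists_isMinWeightPerfectMatching [Fintype M] (hM : Even (Fintype.card M)) :
    ∃ W : (⊤ : SimpleGraph M).Subgraph, IsMinWeightPerfectMatching W := by
  obtain ⟨W, hW, hW'⟩ := (SimpleGraph.IsClique.even_iff_exists_isMatching (G := (⊤ : SimpleGraph M))
    (u := Set.univ) (fun x _ y _ h => h) Set.finite_univ).1 (by
      rwa [Set.ncard_univ, Nat.card_eq_fintype_card])
  let T := {W : (⊤ : SimpleGraph M).Subgraph // W.IsPerfectMatching}
  have : Nonempty T := ⟨⟨W, hW', fun x => by rw [hW]; trivial⟩⟩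
  obtain ⟨⟨W, hW⟩, hmin⟩ := Finite.exists_min fun W : T => weight W.1
  exact ⟨W, hW, fun U hU => hmin ⟨U, hU⟩⟩

/-- A matching of least weight is split by a `1`-Lipschitz map to `ℓ₁ⁿ`. -/
theorem exists_coordinates [Fintype M] (hW : IsMinWeightPerfectMatching W)
    (h : EnumeratesEdges W u v) :
    ∃ φ : Fin n → M → ℝ, (∀ x y, ∑ i, |φ i x - φ i y| ≤ dist x y) ∧
      ∀ i j, φ i (u j) - φ i (v j) = if i = j then dist (u i) (v i) else 0 := by
  -- The graph has all ordered pairs as edges, loops included; `J` contains one orientation of each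
  -- matching edge.
  set J : Finset (M × M) := Finset.univ.image fun i => (u i, v i) with hJ
  have hsum : ∀ {A : Type _} [AddCommMonoid A] (g : M × M → A),
      ∑ e ∈ J, g e = ∑ i, g (u i, v i) := fun g =>
    Finset.sum_image fun i _ j _ hij => h.injective_pair hij
  have hbd : ∀ x, bd Prod.fst Prod.snd J x = 1 := by
    intro x
    rw [bd, Finset.sum_apply, hsum, h.sum_inc hW.1 x]
  obtain ⟨Y, hY, hYJ, hYd, hYJd⟩ := exists_cut_packing Prod.fst Prod.snd (pairDist (M := M))
    pairDist_nonneg J (by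
      intro C hC
      -- All degrees of `symmDiff J C` are odd, so it is at least as long as some perfect matching,
      -- hence as `J`; the difference of the two lengths is the signed weight of `C`.
      obtain ⟨W', hW', hverts, hle⟩ := exists_matching_le Finset.univ (symmDiff J C) (by
        intro x
        rw [bd_symmDiff, hC, add_zero, hbd]
        simp)
      have h1 := hW.2 W' ⟨hW', fun x => by rw [hverts]; simp⟩
      have h2 : ∑ e ∈ symmDiff J C, pairDist e = ∑ e ∈ J \ C, pairDist e + ∑ e ∈ C \ J, pairDist e :=
        Finset.sum_union disjoint_sdiff_sdiff
      have h3 : ∑ e ∈ J ∩ C, pairDist e + ∑ e ∈ J \ C, pairDist e = ∑ e ∈ J, pairDist e :=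
        Finset.sum_inter_add_sum_sdiff J C _
      have h4 : ∑ e ∈ C ∩ J, swt J pairDist e + ∑ e ∈ C \ J, swt J pairDist e
          = ∑ e ∈ C, swt J pairDist e := Finset.sum_inter_add_sum_sdiff C J _
      have h5 : ∑ e ∈ C ∩ J, swt J pairDist e = -∑ e ∈ C ∩ J, pairDist e := by
        rw [← Finset.sum_neg_distrib]
        exact Finset.sum_congr rfl fun e he => if_pos (Finset.mem_inter.1 he).2
      have h6 : ∑ e ∈ C \ J, swt J pairDist e = ∑ e ∈ C \ J, pairDist e :=
        Finset.sum_congr rfl fun e he => if_neg (Finset.mem_sdiff.1 he).2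
      have h7 : weight W = ∑ e ∈ J, pairDist e := by
        rw [h.weight_eq, hsum]
        rfl
      rw [Finset.inter_comm] at h3
      linarith)
  have hcut : ∀ B, Y B ≠ 0 → ∑ i, |ind B (u i) - ind B (v i)| = 1 := by
    intro B hB
    rw [← hYJ B hB, hsum]
    rfl
  have hsq : ∀ (B : Finset M) (x y : M),
      (ind B x - ind B y) * (ind B x - ind B y) = |ind B x - ind B y| := by
    intro B x y
    simp only [ind]
    split_ifs <;> norm_num
  -- The bracket is `±1` for the one pair that crosses `B` and zero for the others, so each cut of
  -- the packing counts in a single coordinate. The sign makes `φ i` larger at `u i` than at `v i`.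
  refine ⟨fun i x => ∑ B, Y B * (ind B (u i) - ind B (v i)) * ind B x, fun x y => ?_,
    fun i j => ?_⟩
  · calc ∑ i, |∑ B, Y B * (ind B (u i) - ind B (v i)) * ind B x
          - ∑ B, Y B * (ind B (u i) - ind B (v i)) * ind B y|
        ≤ ∑ i, ∑ B, Y B * |ind B (u i) - ind B (v i)| * |ind B x - ind B y| := by
          refine Finset.sum_le_sum fun i _ => ?_
          rw [← Finset.sum_sub_distrib]
          refine (Finset.abs_sum_le_sum_abs _ _).trans (Finset.sum_le_sum fun B _ => ?_)
          rw [← mul_sub, abs_mul, abs_mul, abs_of_nonneg (hY B)]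
      _ = ∑ B, Y B * (∑ i, |ind B (u i) - ind B (v i)|) * |ind B x - ind B y| := by
          rw [Finset.sum_comm]
          refine Finset.sum_congr rfl fun B _ => ?_
          rw [Finset.mul_sum, Finset.sum_mul]
      _ = ∑ B, Y B * cut Prod.fst Prod.snd B (x, y) := by
          refine Finset.sum_congr rfl fun B _ => ?_
          by_cases hB : Y B = 0
          · simp [hB]
          · rw [hcut B hB, mul_one]
            rfl
      _ ≤ dist x y := hYd (x, y)
  · rw [← Finset.sum_sub_distrib]
    simp only [← mul_sub]
    split_ifs with hij
    · subst hij
      have h1 := hYJd (u i, v i) (Finset.mem_image_of_mem _ (Finset.mem_univ i))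
      rw [pairDist] at h1
      rw [← h1]
      refine Finset.sum_congr rfl fun B _ => ?_
      rw [mul_assoc, hsq]
      rfl
    · refine Finset.sum_eq_zero fun B _ => ?_
      by_cases hB : Y B = 0
      · simp [hB]
      · have h1 := hcut B hB
        -- Two different pairs cannot both cross `B`, so one of the two factors vanishes.
        have h2 : |ind B (u i) - ind B (v i)| + |ind B (u j) - ind B (v j)| ≤ 1 := by
          rw [← h1, ← Finset.sum_pair (f := fun i => |ind B (u i) - ind B (v i)|) hij]
          exact Finset.sum_le_sum_of_subset_of_nonneg (Finset.subset_univ _)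
            fun _ _ _ => abs_nonneg _
        simp only [ind] at h2 ⊢
        split_ifs at h2 ⊢ <;> first | (norm_num; done) | norm_num at h2

end PerfectMatching

/-! ### The isometry and the projection -/

section Complemented

variable {M : Type*} [MetricSpace M] [Fintype M] {n : ℕ}

/-- The functionals given by a `1`-Lipschitz map to `ℓ₁ⁿ` are the coordinates of a contraction. -/
theorem sum_abs_pairing_le {φ : Fin n → M → ℝ} (hφ : ∀ x y, ∑ i, |φ i x - φ i y| ≤ dist x y)
    (f : TP M) : ∑ i, |pairing (φ i) f| ≤ ‖f‖ := by
  -- With these signs the sum of absolute values is the pairing of `f` with one `1`-Lipschitz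
  -- function.
  let σ : Fin n → ℝ := fun i => SignType.sign (pairing (φ i) f)
  have hσ : ∀ i, |σ i| ≤ 1 := by
    intro i
    simp only [σ]
    cases SignType.sign (pairing (φ i) f) <;> simp
  have h := pairing_le (fun x => ∑ i, σ i * φ i x) (fun x y => by
    rw [← Finset.sum_sub_distrib]
    refine (Finset.sum_le_sum fun i _ => ?_).trans (hφ x y)
    rw [← mul_sub]
    calc σ i * (φ i x - φ i y) ≤ |σ i| * |φ i x - φ i y| := by
          rw [← abs_mul]
          exact le_abs_self _
      _ ≤ 1 * |φ i x - φ i y| := by gcongr; exact hσ i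
      _ = _ := one_mul _) f
  refine le_trans (le_of_eq ?_) h
  rw [pairing_apply]
  simp only [Finset.mul_sum]
  rw [Finset.sum_comm]
  refine Finset.sum_congr rfl fun i _ => ?_
  rw [← sign_mul_self (pairing (φ i) f), pairing_apply, Finset.mul_sum]
  refine Finset.sum_congr rfl fun x _ => ?_
  simp only [σ, pairing_apply]
  ring

/-- The coordinates as a map to `ℓ₁ⁿ`. -/
def coordinates (φ : Fin n → M → ℝ) (hφ : ∀ x y, ∑ i, |φ i x - φ i y| ≤ dist x y) :
    TP M →L[ℝ] EllOne n :=
  LinearMap.mkContinuous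
    { toFun := fun f => WithLp.toLp 1 fun i => pairing (φ i) f
      map_add' := fun f g => by ext i; simp
      map_smul' := fun c f => by ext i; simp } 1 fun f => by
    rw [one_mul, PiLp.norm_eq_of_L1]
    exact sum_abs_pairing_le hφ f

theorem coordinates_apply (φ : Fin n → M → ℝ) (hφ : ∀ x y, ∑ i, |φ i x - φ i y| ≤ dist x y)
    (f : TP M) (i : Fin n) : coordinates φ hφ f i = pairing (φ i) f := rfl

theorem norm_coordinates_le (φ : Fin n → M → ℝ)
    (hφ : ∀ x y, ∑ i, |φ i x - φ i y| ≤ dist x y) (f : TP M) : ‖coordinates φ hφ f‖ ≤ ‖f‖ := by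
  rw [PiLp.norm_eq_of_L1]
  exact sum_abs_pairing_le hφ f

/-- The combinations of the unit problems of the pairs `uᵢ, vᵢ`. -/
def combine (u v : Fin n → M) : EllOne n →ₗ[ℝ] TP M where
  toFun a := ∑ i, a i • (dist (u i) (v i))⁻¹ • delta (u i) (v i)
  map_add' a b := by simp [add_smul, Finset.sum_add_distrib]
  map_smul' c a := by simp [mul_smul, Finset.smul_sum]

theorem combine_apply (u v : Fin n → M) (a : EllOne n) :
    combine u v a = ∑ i, a i • (dist (u i) (v i))⁻¹ • delta (u i) (v i) := rfl

theorem combine_single (u v : Fin n → M) (i : Fin n) :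
    combine u v (PiLp.single 1 i (1 : ℝ)) = (dist (u i) (v i))⁻¹ • delta (u i) (v i) := by
  rw [combine_apply, Finset.sum_eq_single_of_mem i (Finset.mem_univ _)]
  · simp
  · intro j _ hj
    simp [hj]

theorem norm_combine_le (u v : Fin n → M) (a : EllOne n) : ‖combine u v a‖ ≤ ‖a‖ := by
  rw [PiLp.norm_eq_of_L1, combine_apply]
  refine (norm_sum_le _ _).trans (Finset.sum_le_sum fun i _ => ?_)
  rw [norm_smul, norm_smul, norm_inv, Real.norm_of_nonneg dist_nonneg]
  refine mul_le_of_le_one_right (norm_nonneg _) ?_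
  refine (mul_le_mul_of_nonneg_left (norm_delta_le _ _) (inv_nonneg.2 dist_nonneg)).trans ?_
  exact inv_mul_le_one

theorem coordinates_combine {u v : Fin n → M} (huv : ∀ i, u i ≠ v i) {φ : Fin n → M → ℝ}
    (hφ : ∀ x y, ∑ i, |φ i x - φ i y| ≤ dist x y)
    (hφ' : ∀ i j, φ i (u j) - φ i (v j) = if i = j then dist (u i) (v i) else 0) (a : EllOne n) :
    coordinates φ hφ (combine u v a) = a := by
  ext i
  rw [coordinates_apply, combine_apply, map_sum, Finset.sum_eq_single_of_mem i (Finset.mem_univ _)]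
  · rw [map_smul, map_smul, pairing_delta, hφ', if_pos rfl, smul_eq_mul, smul_eq_mul,
      inv_mul_cancel₀ (dist_pos.2 (huv i)).ne', mul_one]
  · intro j _ hj
    rw [map_smul, map_smul, pairing_delta, hφ', if_neg hj.symm, smul_zero, smul_zero]

/-- Both `combine` and `coordinates` are contractions and `coordinates` is a left inverse of
`combine`; hence `combine` is isometric, and `combine` after `coordinates` is the projection. -/
theorem isOneComplemented_span {u v : Fin n → M} (huv : ∀ i, u i ≠ v i) {φ : Fin n → M → ℝ}
    (hφ : ∀ x y, ∑ i, |φ i x - φ i y| ≤ dist x y)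
    (hφ' : ∀ i j, φ i (u j) - φ i (v j) = if i = j then dist (u i) (v i) else 0) :
    let S : Submodule ℝ (TC M) :=
      Submodule.span ℝ (Set.range fun i => ((delta (u i) (v i) : TP M) : TC M))
    IsOneComplemented S ∧
      ∃ J : EllOne n ≃ₗᵢ[ℝ] S, ∀ i : Fin n,
        (J (PiLp.single 1 i (1 : ℝ)) : TC M) =
          (dist (u i) (v i))⁻¹ • ((delta (u i) (v i) : TP M) : TC M) := by
  intro S
  have hTJ := coordinates_combine huv hφ hφ'
  let J₀ : EllOne n →ₗᵢ[ℝ] TC M :=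
    (equivTC M).toLinearIsometry.comp
      ⟨combine u v, fun a => le_antisymm (norm_combine_le u v a) (by
        have h := norm_coordinates_le φ hφ (combine u v a)
        rwa [hTJ] at h)⟩
  have hJ₀ : ∀ a, J₀ a = equivTC M (combine u v a) := fun a => rfl
  have hJ₀s : ∀ i, J₀ (PiLp.single 1 i (1 : ℝ))
      = (dist (u i) (v i))⁻¹ • ((delta (u i) (v i) : TP M) : TC M) := by
    intro i
    rw [hJ₀, combine_single, map_smul, equivTC_apply]
  have hmem : ∀ a, J₀ a ∈ S := by
    intro a
    rw [hJ₀, combine_apply, map_sum]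
    refine sum_mem fun i _ => ?_
    rw [map_smul, map_smul]
    exact S.smul_mem _ (S.smul_mem _ (Submodule.subset_span ⟨i, rfl⟩))
  have hrange : LinearMap.range J₀.toLinearMap = S := by
    refine le_antisymm ?_ (Submodule.span_le.2 ?_)
    · rintro _ ⟨a, rfl⟩
      exact hmem a
    · rintro _ ⟨i, rfl⟩
      refine ⟨dist (u i) (v i) • PiLp.single 1 i (1 : ℝ), ?_⟩
      rw [LinearIsometry.coe_toLinearMap, map_smul, hJ₀s, smul_smul,
        mul_inv_cancel₀ (dist_pos.2 (huv i)).ne', one_smul]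
  refine ⟨⟨J₀.toContinuousLinearMap.comp ((coordinates φ hφ).comp
    ((equivTC M).symm.toContinuousLinearEquiv : TC M →L[ℝ] TP M)), ⟨fun x => hmem _, ?_⟩, ?_⟩, ?_⟩
  · intro x hx
    rw [← hrange] at hx
    obtain ⟨a, rfl⟩ := hx
    change J₀ (coordinates φ hφ ((equivTC M).symm (equivTC M (combine u v a)))) = J₀ a
    rw [LinearIsometryEquiv.symm_apply_apply, hTJ]
  · refine ContinuousLinearMap.opNorm_le_bound _ zero_le_one fun x => ?_
    change ‖J₀ (coordinates φ hφ ((equivTC M).symm x))‖ ≤ 1 * ‖x‖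
    rw [LinearIsometry.norm_map, one_mul]
    exact (norm_coordinates_le φ hφ _).trans (LinearIsometryEquiv.norm_map _ x).le
  · exact ⟨J₀.equivRange.trans (LinearIsometryEquiv.ofEq _ _ hrange), fun i => hJ₀s i⟩

end Complemented

end TransportationCost

end

open TransportationCost in
theorem theorem1p5 {M : Type*} [MetricSpace M] [Fintype M] (n : ℕ)
    (hM : Fintype.card M = 2 * n) :
    (∃ S : Submodule ℝ (TC M), IsOneComplemented S ∧ Nonempty (EllOne n ≃ₗᵢ[ℝ] S)) ∧
    (∃ (W : (⊤ : SimpleGraph M).Subgraph) (u v : Fin n → M),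
      IsMinWeightPerfectMatching W ∧ EnumeratesEdges W u v) ∧
    (∀ (W : (⊤ : SimpleGraph M).Subgraph) (u v : Fin n → M),
      IsMinWeightPerfectMatching W → EnumeratesEdges W u v →
        let S : Submodule ℝ (TC M) :=
          Submodule.span ℝ (Set.range fun i => ((delta (u i) (v i) : TP M) : TC M))
        IsOneComplemented S ∧
          ∃ J : EllOne n ≃ₗᵢ[ℝ] S, ∀ i : Fin n,
            (J (PiLp.single 1 i (1 : ℝ)) : TC M) =
              (dist (u i) (v i))⁻¹ • ((delta (u i) (v i) : TP M) : TC M)) ∧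
    ((∀ x y z : M, x ≠ y → y ≠ z → x ≠ z → dist x z < dist x y + dist y z) →
      ¬ ∃ S : Submodule ℝ (TC M), Nonempty (EllOne (n + 1) ≃ₗᵢ[ℝ] S)) := by
  classical
  have hmain := fun (W : (⊤ : SimpleGraph M).Subgraph) (u v : Fin n → M)
      (hW : IsMinWeightPerfectMatching W) (h : EnumeratesEdges W u v) =>
    isOneComplemented_span h.ne (exists_coordinates hW h).choose_spec.1
      (exists_coordinates hW h).choose_spec.2
  obtain ⟨W, hW⟩ := exists_isMinWeightPerfectMatching (M := M) (hM ▸ even_two_mul n)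
  obtain ⟨u, v, h⟩ := exists_enumeratesEdges hM hW.1
  refine ⟨?_, ⟨W, u, v, hW, h⟩, hmain, ?_⟩
  · obtain ⟨hS, J, -⟩ := hmain W u v hW h
    exact ⟨_, hS, ⟨J⟩⟩
  · rintro hstrict ⟨S, ⟨J⟩⟩
    have := two_mul_le_card hstrict (S.subtypeₗᵢ.comp J.toLinearIsometry)
    omega
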